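/- All graphs are finite, simple and undirected. A matching $M\subseteq E(G)$ of a graph $G$ is called induced if the set of endpoints of the edges of $M$ induces a $1$-regular subgraph of $G$ (the empty matching is induced), and an induced matching is called maximal if it is not a proper subset of another induced matching. Let $M_G$ denote the set of all maximal induced matchings of $G$. Write $G\cup H$ for the disjoint union of $G$ and $H$, and $sG$ for the disjoint union of $s$ copies of $G$. **Theorem.** Let $n\ge 8$ be an integer and let $G$ be a (not necessarily connected) graph with $n$ vertices. Then $$|M_G|\le q(n):=\begin{cases}10^{t} & \text{if } n=5t,\\ 15\cdot 10^{t-1} & \text{if } n=5t+1,\\ 225\cdot 10^{t-2} & \text{if } n=5t+2,\\ 36\cdot 10^{t-1} & \text{if } n=5t+3,\\ 6\cdot 10^{t} & \text{if } n=5t+4,\end{cases}$$ where $t$ is a positive integer, and equality $|M_G|=q(n)$ holds if and only if $G$ is isomorphic to $$Q_n:=\begin{cases}tK_5 & \text{if } n=5t,\\ K_6\cup (t-1)K_5 & \text{if } n=5t+1,\\ 2K_6\cup (t-2)K_5 & \text{if } n=5t+2,\\ 2K_4\cup (t-1)K_5 & \text{if } n=5t+3,\\ K_4\cup tK_5 &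 \text{if } n=5t+4.\end{cases}$$ -/

import Mathlib

namespace SimpleGraph

/-- The set `V(M)` of vertices covered by a set `M` of edges. -/
def coveredVerts {V : Type*} (M : Set (Sym2 V)) : Set V :=
  {v | ∃ e ∈ M, v ∈ e}

/-- `M` is a matching of `G`: a set of pairwise disjoint edges of `G`. -/
def IsEdgeMatching {V : Type*} (G : SimpleGraph V) (M : Set (Sym2 V)) : Prop :=
  M ⊆ G.edgeSet ∧ ∀ e ∈ M, ∀ f ∈ M, ∀ v : V, v ∈ e → v ∈ f → e = f

/-- `M` is an induced matching of `G`: a matching whose covered vertices induce a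
`1`-regular subgraph of `G`. The empty matching is included. -/
def IsInducedMatching {V : Type*} (G : SimpleGraph V) (M : Set (Sym2 V)) : Prop :=
  G.IsEdgeMatching M ∧ ∀ v ∈ coveredVerts M, ∃! w, w ∈ coveredVerts M ∧ G.Adj v w

/-- The set of maximal (with respect to inclusion) induced matchings of `G`. -/
def maximalInducedMatchings {V : Type*} (G : SimpleGraph V) : Set (Set (Sym2 V)) :=
  {M | Maximal G.IsInducedMatching M}

/-- `sK_r`: the disjoint union of `s` copies of the complete graph on `r` vertices. -/
def copiesK (s r : ℕ) : SimpleGraph (Fin s × Fin r) where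
  Adj a b := a.1 = b.1 ∧ a.2 ≠ b.2
  symm := ⟨fun _ _ h => ⟨h.1.symm, h.2.symm⟩⟩
  loopless := ⟨fun _ h => h.2 rfl⟩

/-- The bound `q(n)`, with `t = n / 5` (intended for `n ≥ 8`, where no subtraction truncates). -/
def qBound (n : ℕ) : ℕ :=
  match n % 5 with
  | 0 => 10 ^ (n / 5)
  | 1 => 15 * 10 ^ (n / 5 - 1)
  | 2 => 225 * 10 ^ (n / 5 - 2)
  | 3 => 36 * 10 ^ (n / 5 - 1)
  | _ => 6 * 10 ^ (n / 5)

/-- `G` is (isomorphic to) the graph `Q_n`, with `t = n / 5` (intended for `n ≥ 8`). -/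
def IsQGraph {V : Type*} (n : ℕ) (G : SimpleGraph V) : Prop :=
  match n % 5 with
  | 0 => Nonempty (G ≃g copiesK (n / 5) 5)
  | 1 => Nonempty (G ≃g (copiesK 1 6 ⊕g copiesK (n / 5 - 1) 5))
  | 2 => Nonempty (G ≃g (copiesK 2 6 ⊕g copiesK (n / 5 - 2) 5))
  | 3 => Nonempty (G ≃g (copiesK 2 4 ⊕g copiesK (n / 5 - 1) 5))
  | _ => Nonempty (G ≃g (copiesK 1 4 ⊕g copiesK (n / 5) 5))

end SimpleGraph

/-!
The proof is by branching at a vertex `v` of maximum degree `d`. A maximal induced matching of `G`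
either leaves `v` uncovered, and is then maximal in `G - v`, or contains an edge `vw`, and the rest
of it is then maximal in `G - N[v] - N[w]` (`mimCount_le_branch`). Counts multiply over disjoint
unions (`mimCount_eq_mul`). Vertices are deleted by deleting the edges at them, so that all graphs
live on one vertex type and the induction is over a set `S` containing all edges.

Write `q` also for the extension of the bound to all `n` by `q (n + 5) = 10 * q n` with initial
values `1`, `3/2`, `9/4`, `18/5`, `6`; then no base cases are needed. Call a neighbour `w` of `v`
full if `N[w] ⊆ N[v]`. If `j` neighbours of `v` are not full, branching gives at most
`q (n - 1) + (d - j) * q (n - d - 1) + j * q (n - d - 2)` matchings (`BoundBelow.branch`).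

* For `j = 0` the set `N[v]` is a component, which contributes at most `(d + 1).choose 2`, with
  equality only for a complete graph (`BoundBelow.component`). Equality in the bound for `G` then
  occurs only for `K₄`, `K₅` or `K₆` next to an extremal graph (`scaledBound_clique`,
  `boundedOn_of_component`).
* For `d ≥ 6`, for `d = 5` with `j ≥ 1`, for `d = 4` with `j ≥ 3`, and for `j = d ∈ {2, 3}` the
  displayed sum is smaller than `q n`.
* For `j = 1` and `d ≤ 4`, branching at the neighbour that is not full separates `N[v]` from the
  rest (`BoundBelow.lt_of_cut_vertex`).
* For `d = 4`, `j = 2` the sum is at most `q n`, with equality only if `G - v` is extremal on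
  `0` or `1` modulo `5` vertices; but then all its degrees are at least `4`, which fails at the
  neighbours of `v`.
* For `d = 3`, `j = 2` the few possible neighbourhoods are treated by branching at a better vertex
  or twice (`BoundBelow.lt_of_degree_three`).
-/

namespace SimpleGraph

variable {V W : Type*}

/-! ### Maximal induced matchings and edge conflicts -/

/-- Two edges conflict in `G` if they share a vertex or are joined by an edge of `G`, that is, if
they cannot be distinct members of one induced matching. -/
def EdgeConflict (G : SimpleGraph V) (e f : Sym2 V) : Prop :=
  ∃ a ∈ e, ∃ b ∈ f, a = b ∨ G.Adj a b

lemma EdgeConflict.refl (G : SimpleGraph V) (e : Sym2 V) : G.EdgeConflict e e := by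
  induction e with
  | h x y => exact ⟨x, by simp, x, by simp, Or.inl rfl⟩

lemma EdgeConflict.symm {G : SimpleGraph V} {e f : Sym2 V} (h : G.EdgeConflict e f) :
    G.EdgeConflict f e := by
  obtain ⟨a, ha, b, hb, h⟩ := h
  exact ⟨b, hb, a, ha, h.imp Eq.symm Adj.symm⟩

lemma isInducedMatching_iff {G : SimpleGraph V} {M : Set (Sym2 V)} :
    G.IsInducedMatching M ↔
      M ⊆ G.edgeSet ∧ ∀ e ∈ M, ∀ f ∈ M, G.EdgeConflict e f → e = f := by
  constructor
  · rintro ⟨⟨hE, hM⟩, hI⟩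
    refine ⟨hE, ?_⟩
    rintro e he f hf ⟨a, ha, b, hb, rfl | hab⟩
    · exact hM e he f hf a ha hb
    · obtain ⟨c, rfl⟩ := ha
      obtain ⟨w, -, hw⟩ := hI a ⟨_, he, by simp⟩
      have h1 := hw c ⟨⟨_, he, by simp⟩, hE he⟩
      have h2 := hw b ⟨⟨_, hf, hb⟩, hab⟩
      subst h1
      subst h2
      exact hM _ he f hf b (by simp) hb
  · rintro ⟨hE, hM⟩
    refine ⟨⟨hE, fun e he f hf v hve hvf => hM e he f hf ⟨v, hve, v, hvf, Or.inl rfl⟩⟩, ?_⟩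
    rintro v ⟨e, he, hve⟩
    obtain ⟨w, rfl⟩ := hve
    have hvw : G.Adj v w := hE he
    refine ⟨w, ⟨⟨_, he, by simp⟩, hvw⟩, ?_⟩
    rintro y ⟨⟨f, hf, hyf⟩, hvy⟩
    have := hM _ he f hf ⟨v, by simp, y, hyf, Or.inr hvy⟩
    subst this
    rcases Sym2.mem_iff.1 hyf with h | h
    · exact absurd h hvy.ne'
    · exact h

/-- The maximal induced matchings are the conflict-free sets of edges that dominate every edge. -/
lemma mem_maximalInducedMatchings_iff {G : SimpleGraph V} {M : Set (Sym2 V)} :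
    M ∈ G.maximalInducedMatchings ↔
      M ⊆ G.edgeSet ∧ (∀ e ∈ M, ∀ f ∈ M, G.EdgeConflict e f → e = f) ∧
        ∀ e ∈ G.edgeSet, ∃ f ∈ M, G.EdgeConflict e f := by
  constructor
  · rintro ⟨hM, hmax⟩
    obtain ⟨hE, hI⟩ := isInducedMatching_iff.1 hM
    refine ⟨hE, hI, fun e he => ?_⟩
    by_contra! hcon
    have hins : G.IsInducedMatching (insert e M) := by
      refine isInducedMatching_iff.2 ⟨Set.insert_subset he hE, ?_⟩
      rintro f (rfl | hf) g (rfl | hg) hfg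
      · rfl
      · exact absurd hfg (hcon g hg)
      · exact absurd hfg.symm (hcon f hf)
      · exact hI f hf g hg hfg
    have : e ∈ M := hmax hins (Set.subset_insert e M) (Set.mem_insert e M)
    exact hcon e this (EdgeConflict.refl G e)
  · rintro ⟨hE, hI, hdom⟩
    refine ⟨isInducedMatching_iff.2 ⟨hE, hI⟩, fun N hN hMN e he => ?_⟩
    obtain ⟨hNE, hNI⟩ := isInducedMatching_iff.1 hN
    obtain ⟨f, hf, hef⟩ := hdom e (hNE he)
    rwa [hNI e he f (hMN hf) hef]

/-- The number of maximal induced matchings of `G`. -/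
noncomputable def mimCount (G : SimpleGraph V) : ℕ := G.maximalInducedMatchings.ncard

/-- The graph obtained from `G` by deleting all edges that meet `X`. It stands for the
vertex-deleted graph `G - X`: isolated vertices do not affect induced matchings, and keeping them
keeps the vertex type fixed. -/
def isolate (G : SimpleGraph V) (X : Set V) : SimpleGraph V where
  Adj a b := G.Adj a b ∧ a ∉ X ∧ b ∉ X
  symm := ⟨fun _ _ h => ⟨h.1.symm, h.2.2, h.2.1⟩⟩
  loopless := ⟨fun _ h => h.1.ne rfl⟩

@[simp] lemma isolate_adj {G : SimpleGraph V} {X : Set V} {a b : V} :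
    (G.isolate X).Adj a b ↔ G.Adj a b ∧ a ∉ X ∧ b ∉ X := Iff.rfl

lemma mem_edgeSet_isolate {G : SimpleGraph V} {X : Set V} {e : Sym2 V} :
    e ∈ (G.isolate X).edgeSet ↔ e ∈ G.edgeSet ∧ ∀ a ∈ e, a ∉ X := by
  induction e with
  | h x y => simp

lemma edgeConflict_isolate {G : SimpleGraph V} {X : Set V} {e f : Sym2 V}
    (he : ∀ a ∈ e, a ∉ X) (hf : ∀ a ∈ f, a ∉ X) :
    (G.isolate X).EdgeConflict e f ↔ G.EdgeConflict e f := by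
  constructor
  · rintro ⟨a, ha, b, hb, h⟩
    exact ⟨a, ha, b, hb, h.imp id fun h => h.1⟩
  · rintro ⟨a, ha, b, hb, h⟩
    exact ⟨a, ha, b, hb, h.imp id fun h => ⟨h, he a ha, hf b hb⟩⟩

lemma mem_maximalInducedMatchings_isolate {G : SimpleGraph V} {X : Set V} {M : Set (Sym2 V)} :
    M ∈ (G.isolate X).maximalInducedMatchings ↔
      (∀ e ∈ M, e ∈ G.edgeSet ∧ ∀ a ∈ e, a ∉ X) ∧
        (∀ e ∈ M, ∀ f ∈ M, G.EdgeConflict e f → e = f) ∧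
        ∀ e ∈ G.edgeSet, (∀ a ∈ e, a ∉ X) → ∃ f ∈ M, G.EdgeConflict e f := by
  rw [mem_maximalInducedMatchings_iff]
  simp only [Set.subset_def, mem_edgeSet_isolate]
  refine and_congr_right fun h1 => and_congr ?_ ?_
  · refine forall₂_congr fun e he => forall₂_congr fun f hf => ?_
    rw [edgeConflict_isolate (h1 e he).2 (h1 f hf).2]
  · constructor
    · intro h e he hX
      obtain ⟨f, hf, hc⟩ := h e ⟨he, hX⟩
      exact ⟨f, hf, (edgeConflict_isolate hX (h1 f hf).2).1 hc⟩
    · rintro h e ⟨he, hX⟩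
      obtain ⟨f, hf, hc⟩ := h e he hX
      exact ⟨f, hf, (edgeConflict_isolate hX (h1 f hf).2).2 hc⟩

/-- A graph whose edges are pairwise conflict-free has only one maximal induced matching. -/
lemma mimCount_eq_one {G : SimpleGraph V}
    (h : ∀ e ∈ G.edgeSet, ∀ f ∈ G.edgeSet, G.EdgeConflict e f → e = f) : G.mimCount = 1 := by
  have : G.maximalInducedMatchings = {G.edgeSet} := by
    ext M
    rw [mem_maximalInducedMatchings_iff, Set.mem_singleton_iff]
    constructor
    · rintro ⟨hE, -, hdom⟩
      refine hE.antisymm fun e he => ?_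
      obtain ⟨f, hf, hc⟩ := hdom e he
      rwa [h e he f (hE hf) hc]
    · rintro rfl
      exact ⟨subset_rfl, h, fun e he => ⟨e, he, EdgeConflict.refl G e⟩⟩
  rw [mimCount, this, Set.ncard_singleton]

/-- The number of maximal induced matchings is multiplicative over vertex sets without edges
between them. -/
lemma mimCount_eq_mul [Finite V] {G : SimpleGraph V} {X : Set V}
    (hX : ∀ a b, G.Adj a b → a ∈ X → b ∈ X) :
    G.mimCount = (G.isolate X).mimCount * (G.isolate Xᶜ).mimCount := by
  have hedge : ∀ e ∈ G.edgeSet, (∀ a ∈ e, a ∉ X) ∨ ∀ a ∈ e, a ∉ Xᶜ := by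
    intro e
    induction e with
    | h x y =>
      intro hxy
      have h1 := hX x y hxy
      have h2 := hX y x hxy.symm
      by_cases hx : x ∈ X
      · right
        simp [hx, h1 hx]
      · left
        simp only [Sym2.mem_iff, forall_eq_or_imp, forall_eq]
        exact ⟨hx, fun h => hx (h2 h)⟩
  have hcross : ∀ e f, (∀ a ∈ e, a ∉ X) → (∀ a ∈ f, a ∉ Xᶜ) → ¬ G.EdgeConflict e f := by
    rintro e f he hf ⟨a, ha, b, hb, rfl | hab⟩
    · exact hf a hb (he a ha)
    · exact he a ha (hX b a hab.symm (not_not.1 (hf b hb)))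
  have himg : G.maximalInducedMatchings =
      (fun p : Set (Sym2 V) × Set (Sym2 V) => p.1 ∪ p.2) ''
        ((G.isolate X).maximalInducedMatchings ×ˢ (G.isolate Xᶜ).maximalInducedMatchings) := by
    ext M
    rw [mem_maximalInducedMatchings_iff]
    simp only [Set.mem_image, Set.mem_prod, Prod.exists, mem_maximalInducedMatchings_isolate]
    constructor
    · rintro ⟨hE, hI, hdom⟩
      refine ⟨{e ∈ M | ∀ a ∈ e, a ∉ X}, {e ∈ M | ∀ a ∈ e, a ∉ Xᶜ},
        ⟨⟨fun e he => ⟨hE he.1, he.2⟩, fun e he f hf => hI e he.1 f hf.1, fun e he heX => ?_⟩,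
          fun e he => ⟨hE he.1, he.2⟩, fun e he f hf => hI e he.1 f hf.1, fun e he heX => ?_⟩, ?_⟩
      · obtain ⟨f, hf, hc⟩ := hdom e he
        exact ⟨f, ⟨hf, (hedge f (hE hf)).resolve_right fun h => hcross e f heX h hc⟩, hc⟩
      · obtain ⟨f, hf, hc⟩ := hdom e he
        exact ⟨f, ⟨hf, (hedge f (hE hf)).resolve_left fun h => hcross f e h heX hc.symm⟩, hc⟩
      · ext e
        constructor
        · rintro (h | h)
          exacts [h.1, h.1]
        · intro h
          exact (hedge e (hE h)).imp (⟨h, ·⟩) (⟨h, ·⟩)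
    · rintro ⟨M, N, ⟨⟨hM, hMI, hMd⟩, hN, hNI, hNd⟩, rfl⟩
      refine ⟨Set.union_subset (fun e he => (hM e he).1) fun e he => (hN e he).1, ?_, ?_⟩
      · rintro e (he | he) f (hf | hf) hc
        · exact hMI e he f hf hc
        · exact absurd hc (hcross e f (hM e he).2 (hN f hf).2)
        · exact absurd hc.symm (hcross f e (hM f hf).2 (hN e he).2)
        · exact hNI e he f hf hc
      · intro e he
        rcases hedge e he with h | h
        · obtain ⟨f, hf, hc⟩ := hMd e he h
          exact ⟨f, Or.inl hf, hc⟩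
        · obtain ⟨f, hf, hc⟩ := hNd e he h
          exact ⟨f, Or.inr hf, hc⟩
  rw [mimCount, himg, Set.InjOn.ncard_image, Set.ncard_prod]
  · rfl
  · rintro ⟨M, N⟩ ⟨hM, hN⟩ ⟨M', N'⟩ ⟨hM', hN'⟩ h
    rw [mem_maximalInducedMatchings_isolate] at hM hN hM' hN'
    have hne : ∀ e : Sym2 V, (∀ a ∈ e, a ∉ X) → (∀ a ∈ e, a ∉ Xᶜ) → False :=
      fun e h1 h2 => hcross e e h1 h2 (EdgeConflict.refl G e)
    have h' : ∀ e, (e ∈ M ∨ e ∈ N) ↔ (e ∈ M' ∨ e ∈ N') := fun e => Set.ext_iff.1 h e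
    refine Prod.ext (Set.ext fun e => ?_) (Set.ext fun e => ?_)
    · constructor
      · intro he
        exact ((h' e).1 (Or.inl he)).resolve_right fun h2 => hne e (hM.1 e he).2 (hN'.1 e h2).2
      · intro he
        exact ((h' e).2 (Or.inl he)).resolve_right fun h2 => hne e (hM'.1 e he).2 (hN.1 e h2).2
    · constructor
      · intro he
        exact ((h' e).1 (Or.inr he)).resolve_left fun h2 => hne e (hM'.1 e h2).2 (hN.1 e he).2
      · intro he
        exact ((h' e).2 (Or.inr he)).resolve_left fun h2 => hne e (hM.1 e h2).2 (hN'.1 e he).2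

lemma mimCount_map [Finite W] (G : SimpleGraph V) (f : V ↪ W) :
    (G.map f).mimCount = G.mimCount := by
  have hc : ∀ e e' : Sym2 V,
      (G.map f).EdgeConflict (e.map f) (e'.map f) ↔ G.EdgeConflict e e' := by
    intro e e'
    simp only [EdgeConflict, Sym2.mem_map]
    constructor
    · rintro ⟨_, ⟨a, ha, rfl⟩, _, ⟨b, hb, rfl⟩, h⟩
      exact ⟨a, ha, b, hb, h.imp (fun h => f.injective h) (SimpleGraph.map_adj_apply).1⟩
    · rintro ⟨a, ha, b, hb, h⟩
      exact ⟨_, ⟨a, ha, rfl⟩, _, ⟨b, hb, rfl⟩,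
        h.imp (fun h => congrArg f h) (SimpleGraph.map_adj_apply).2⟩
  have hinj : Function.Injective (Sym2.map f) := Sym2.map.injective f.injective
  have hE : (G.map f).edgeSet = Sym2.map f '' G.edgeSet := SimpleGraph.edgeSet_map f G
  have hmem : ∀ M : Set (Sym2 V), Sym2.map f '' M ∈ (G.map f).maximalInducedMatchings ↔
      M ∈ G.maximalInducedMatchings := by
    intro M
    rw [mem_maximalInducedMatchings_iff, mem_maximalInducedMatchings_iff, hE,
      Set.image_subset_image_iff hinj]
    simp only [Set.forall_mem_image, Set.exists_mem_image, hc, hinj.eq_iff]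
  have himg : (G.map f).maximalInducedMatchings =
      Set.image (Sym2.map f) '' G.maximalInducedMatchings := by
    ext M
    constructor
    · intro hM
      have hsub := (mem_maximalInducedMatchings_iff.1 hM).1
      rw [hE] at hsub
      obtain ⟨N, -, rfl⟩ := Set.subset_image_iff.1 hsub
      exact ⟨N, (hmem N).1 hM, rfl⟩
    · rintro ⟨N, hN, rfl⟩
      exact (hmem N).2 hN
  rw [mimCount, himg, Set.ncard_image_of_injective _ hinj.image_injective, mimCount]

lemma mimCount_congr [Finite W] {G : SimpleGraph V} {H : SimpleGraph W} (e : G ≃g H) :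
    G.mimCount = H.mimCount := by
  rw [← mimCount_map G e.toEquiv.toEmbedding]
  congr 1
  ext a b
  constructor
  · rintro ⟨-, x, y, h, rfl, rfl⟩
    exact e.map_adj_iff.2 h
  · intro h
    have : G.Adj (e.symm a) (e.symm b) := e.symm.map_adj_iff.2 h
    exact ⟨h.ne, _, _, this, e.apply_symm_apply a, e.apply_symm_apply b⟩

lemma mimCount_sum [Finite V] [Finite W] (G : SimpleGraph V) (H : SimpleGraph W) :
    (G ⊕g H).mimCount = G.mimCount * H.mimCount := by
  rw [mimCount_eq_mul (X := Set.range Sum.inr),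
    ← mimCount_map G (Function.Embedding.inl (β := W)),
    ← mimCount_map H (Function.Embedding.inr (α := V))]
  · congr 2
    · ext a b
      rcases a with a | a <;> rcases b with b | b <;> simp [SimpleGraph.map_adj]
    · ext a b
      rcases a with a | a <;> rcases b with b | b <;> simp [SimpleGraph.map_adj]
  · rintro (a | a) (b | b) h ha <;> simp_all

/-- In a complete graph any two edges conflict, so the maximal induced matchings are the single
edges. -/
lemma mimCount_top [Fintype V] [Nontrivial V] :
    (⊤ : SimpleGraph V).mimCount = (Fintype.card V).choose 2 := by
  classical
  have hc : ∀ e f : Sym2 V, (⊤ : SimpleGraph V).EdgeConflict e f := by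
    intro e f
    induction e with
    | h x y =>
      induction f with
      | h z t => exact ⟨x, by simp, z, by simp, by simpa using eq_or_ne x z⟩
  have himg : (⊤ : SimpleGraph V).maximalInducedMatchings =
      (fun e => {e}) '' (⊤ : SimpleGraph V).edgeSet := by
    ext M
    rw [mem_maximalInducedMatchings_iff]
    constructor
    · rintro ⟨hE, hI, hdom⟩
      obtain ⟨x, y, hxy⟩ := exists_pair_ne V
      obtain ⟨f, hf, -⟩ := hdom s(x, y) hxy
      exact ⟨f, hE hf, Set.ext fun e =>
        ⟨fun h => by rw [Set.mem_singleton_iff.1 h]; exact hf, fun h => hI e h f hf (hc e f)⟩⟩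
    · rintro ⟨e, he, rfl⟩
      refine ⟨Set.singleton_subset_iff.2 he, ?_, fun f _ => ⟨e, rfl, hc f e⟩⟩
      rintro _ rfl _ rfl -
      rfl
  rw [mimCount, himg, Set.ncard_image_of_injective _ Set.singleton_injective,
    ← SimpleGraph.card_edgeFinset_top_eq_card_choose_two, ← SimpleGraph.coe_edgeFinset,
    Set.ncard_coe_finset]

/-! ### The extremal graphs and the numerical bound -/

/-- `100 * q(n)`, where `q` is extended to all `n` by the rule `q (n + 5) = 10 * q n`; the factor
`100` clears the denominators of the values `3/2`, `9/4`, `18/5` at `1`, `2`, `3`. -/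
def scaledBound : ℕ → ℕ
  | 0 => 100
  | 1 => 150
  | 2 => 225
  | 3 => 360
  | 4 => 600
  | n + 5 => 10 * scaledBound n

lemma scaledBound_add_five (n : ℕ) : scaledBound (n + 5) = 10 * scaledBound n := by
  rw [scaledBound]

lemma scaledBound_add_five_mul (r t : ℕ) :
    scaledBound (r + 5 * t) = 10 ^ t * scaledBound r := by
  induction t with
  | zero => simp
  | succ t ih => rw [mul_add, mul_one, ← add_assoc, scaledBound_add_five, ih, pow_succ]; ring

lemma scaledBound_pos (n : ℕ) : 0 < scaledBound n := by
  induction n using scaledBound.induct <;> simp_all [scaledBound]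

lemma three_mul_scaledBound_le (n : ℕ) : 3 * scaledBound n ≤ 2 * scaledBound (n + 1) := by
  induction n using scaledBound.induct with
  | case6 n ih =>
    rw [show n + 5 + 1 = n + 1 + 5 by omega]
    simp only [scaledBound_add_five]
    omega
  | _ => simp [scaledBound]

lemma scaledBound_strictMono : StrictMono scaledBound := by
  refine strictMono_nat_of_lt_succ fun n => ?_
  have := three_mul_scaledBound_le n
  have := scaledBound_pos n
  omega

lemma scaledBound_mono {m n : ℕ} (h : m ≤ n) : scaledBound m ≤ scaledBound n :=
  scaledBound_strictMono.monotone h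

lemma hundred_mul_qBound {n : ℕ} (hn : 8 ≤ n) : 100 * qBound n = scaledBound n := by
  have hr : n % 5 < 5 := Nat.mod_lt _ (by norm_num)
  have hnt : n = n % 5 + 5 * (n / 5) := (Nat.mod_add_div n 5).symm
  obtain ⟨t, ht⟩ : ∃ t, n / 5 = t := ⟨_, rfl⟩
  obtain ⟨r, hr'⟩ : ∃ r, n % 5 = r := ⟨_, rfl⟩
  rw [hr', ht] at hnt
  rw [qBound, hr', ht, hnt, scaledBound_add_five_mul]
  rw [hr'] at hr
  interval_cases r
  · simp [scaledBound]; ring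
  · obtain ⟨s, rfl⟩ : ∃ s, t = s + 1 := ⟨t - 1, by omega⟩
    simp [scaledBound, pow_succ]; ring
  · obtain ⟨s, rfl⟩ : ∃ s, t = s + 2 := ⟨t - 2, by omega⟩
    simp [scaledBound, pow_succ]; ring
  · obtain ⟨s, rfl⟩ : ∃ s, t = s + 1 := ⟨t - 1, by omega⟩
    simp [scaledBound, pow_succ]; ring
  · simp [scaledBound]; ring

/-- The disjoint union of `a` copies of `K₄`, `c` copies of `K₆` and `b` copies of `K₅`. -/
abbrev cliqueUnion (a b c : ℕ) :
    SimpleGraph (Fin a × Fin 4 ⊕ (Fin c × Fin 6 ⊕ Fin b × Fin 5)) :=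
  copiesK a 4 ⊕g (copiesK c 6 ⊕g copiesK b 5)

/-- The numbers `a`, `b`, `c` of components `K₄`, `K₅`, `K₆` in an extremal graph on `n` vertices.
For each `n` there is at most one such triple. -/
def IsExtremalShape (n a b c : ℕ) : Prop :=
  a ≤ 2 ∧ c ≤ 2 ∧ (a = 0 ∨ c = 0) ∧ 4 * a + 5 * b + 6 * c = n

lemma IsExtremalShape.scaledBound_eq {n a b c : ℕ} (h : IsExtremalShape n a b c) :
    scaledBound n = 100 * (6 ^ a * (15 ^ c * 10 ^ b)) := by
  obtain ⟨ha, hc, hac, rfl⟩ := h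
  rw [show 4 * a + 5 * b + 6 * c = (4 * a + 6 * c) + 5 * b by ring, scaledBound_add_five_mul]
  interval_cases a <;> interval_cases c <;> simp_all [scaledBound] <;> ring

/-- The empty graph `copiesK 0 k` is neutral for disjoint sums. -/
def copiesKZeroSumIso (k : ℕ) (H : SimpleGraph W) : (copiesK 0 k ⊕g H) ≃g H where
  toEquiv := Equiv.emptySum _ _
  map_rel_iff' := by
    rintro (⟨x, -⟩ | a) (⟨y, -⟩ | b)
    · exact x.elim0
    · exact x.elim0
    · exact y.elim0
    · rfl

/-- Splitting off one clique from `s + 1` copies of it. -/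
def copiesKSuccIso (s k : ℕ) :
    ((⊤ : SimpleGraph (Fin k)) ⊕g copiesK s k) ≃g copiesK (s + 1) k where
  toFun := Sum.elim (fun x => (0, x)) (fun p => (p.1.succ, p.2))
  invFun p := Fin.cases (motive := fun _ => Fin k ⊕ Fin s × Fin k) (Sum.inl p.2)
    (fun i => Sum.inr (i, p.2)) p.1
  left_inv := by rintro (x | ⟨i, x⟩) <;> simp
  right_inv := by
    rintro ⟨i, x⟩
    refine Fin.cases ?_ (fun i => ?_) i <;> simp
  map_rel_iff' := by
    rintro (x | ⟨i, x⟩) (y | ⟨j, y⟩) <;> simp [copiesK, Fin.succ_ne_zero, eq_comm]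

lemma mimCount_copiesK (s : ℕ) {k : ℕ} (hk : 2 ≤ k) :
    (copiesK s k).mimCount = (k.choose 2) ^ s := by
  induction s with
  | zero =>
    rw [pow_zero]
    refine mimCount_eq_one fun e => ?_
    induction e with
    | h x y => exact x.1.elim0
  | succ s ih =>
    have : Nontrivial (Fin k) := Fin.nontrivial_iff_two_le.2 hk
    rw [← mimCount_congr (copiesKSuccIso s k), mimCount_sum, ih, mimCount_top, Fintype.card_fin,
      pow_succ, mul_comm]

lemma mimCount_cliqueUnion (a b c : ℕ) :
    (cliqueUnion a b c).mimCount = 6 ^ a * (15 ^ c * 10 ^ b) := by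
  rw [mimCount_sum, mimCount_sum, mimCount_copiesK _ (by norm_num),
    mimCount_copiesK _ (by norm_num), mimCount_copiesK _ (by norm_num)]
  norm_num [Nat.choose]

/-- Exchanging the first two summands of a disjoint sum of three graphs. -/
def sumLeftCommIso {U : Type*} (F : SimpleGraph U) (G : SimpleGraph V) (H : SimpleGraph W) :
    (F ⊕g (G ⊕g H)) ≃g (G ⊕g (F ⊕g H)) :=
  (Iso.sumAssoc.symm.trans (Iso.sumCongr Iso.sumComm Iso.refl)).trans Iso.sumAssoc

lemma nonempty_iso_cliqueUnion_succ_left {G : SimpleGraph V} {a b c : ℕ}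
    (h : Nonempty (G ≃g ((⊤ : SimpleGraph (Fin 4)) ⊕g cliqueUnion a b c))) :
    Nonempty (G ≃g cliqueUnion (a + 1) b c) := by
  obtain ⟨e⟩ := h
  exact ⟨(e.trans Iso.sumAssoc.symm).trans (Iso.sumCongr (copiesKSuccIso a 4) Iso.refl)⟩

lemma nonempty_iso_cliqueUnion_succ_right {G : SimpleGraph V} {a b c : ℕ}
    (h : Nonempty (G ≃g ((⊤ : SimpleGraph (Fin 6)) ⊕g cliqueUnion a b c))) :
    Nonempty (G ≃g cliqueUnion a b (c + 1)) := by
  obtain ⟨e⟩ := h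
  exact ⟨(e.trans (sumLeftCommIso _ _ _)).trans (Iso.sumCongr Iso.refl
    (Iso.sumAssoc.symm.trans (Iso.sumCongr (copiesKSuccIso c 6) Iso.refl)))⟩

lemma nonempty_iso_cliqueUnion_succ_middle {G : SimpleGraph V} {a b c : ℕ}
    (h : Nonempty (G ≃g ((⊤ : SimpleGraph (Fin 5)) ⊕g cliqueUnion a b c))) :
    Nonempty (G ≃g cliqueUnion a (b + 1) c) := by
  obtain ⟨e⟩ := h
  exact ⟨(e.trans (sumLeftCommIso _ _ _)).trans (Iso.sumCongr Iso.refl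
    ((sumLeftCommIso _ _ _).trans (Iso.sumCongr Iso.refl (copiesKSuccIso b 5))))⟩

lemma nonempty_iso_congr_right {U : Type*} {G : SimpleGraph V} {H : SimpleGraph W}
    {H' : SimpleGraph U} (e : H ≃g H') : Nonempty (G ≃g H) ↔ Nonempty (G ≃g H') :=
  ⟨fun ⟨f⟩ => ⟨f.trans e⟩, fun ⟨f⟩ => ⟨f.trans e.symm⟩⟩

lemma isQGraph_iff {G : SimpleGraph V} {n : ℕ} (hn : 8 ≤ n) :
    IsQGraph n G ↔ ∃ a b c, IsExtremalShape n a b c ∧ Nonempty (G ≃g cliqueUnion a b c) := by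
  have key : ∀ {P : Prop} (a b c : ℕ), IsExtremalShape n a b c →
      (P ↔ Nonempty (G ≃g cliqueUnion a b c)) →
      (P ↔ ∃ a b c, IsExtremalShape n a b c ∧ Nonempty (G ≃g cliqueUnion a b c)) := by
    intro P a b c hs hP
    rw [hP]
    refine ⟨fun h => ⟨a, b, c, hs, h⟩, ?_⟩
    rintro ⟨a', b', c', hs', h⟩
    unfold IsExtremalShape at hs hs'
    obtain ⟨rfl, rfl, rfl⟩ : a' = a ∧ b' = b ∧ c' = c := by omega
    exact h
  rcases (by omega : n % 5 = 0 ∨ n % 5 = 1 ∨ n % 5 = 2 ∨ n % 5 = 3 ∨ n % 5 = 4) with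
    h | h | h | h | h <;> simp only [IsQGraph, h]
  · exact key 0 (n / 5) 0 (by unfold IsExtremalShape; omega) (nonempty_iso_congr_right
      ((copiesKZeroSumIso 4 _).trans (copiesKZeroSumIso 6 _)).symm)
  · exact key 0 (n / 5 - 1) 1 (by unfold IsExtremalShape; omega) (nonempty_iso_congr_right
      (copiesKZeroSumIso 4 _).symm)
  · exact key 0 (n / 5 - 2) 2 (by unfold IsExtremalShape; omega) (nonempty_iso_congr_right
      (copiesKZeroSumIso 4 _).symm)
  · exact key 2 (n / 5 - 1) 0 (by unfold IsExtremalShape; omega) (nonempty_iso_congr_right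
      (Iso.sumCongr Iso.refl (copiesKZeroSumIso 6 _).symm))
  · exact key 1 (n / 5) 0 (by unfold IsExtremalShape; omega) (nonempty_iso_congr_right
      (Iso.sumCongr Iso.refl (copiesKZeroSumIso 6 _).symm))

/-! ### Numerical inequalities -/

/-- All values of `scaledBound` in the window `[n - K, n]` are a common multiple of its values in
a window starting below `5`; this reduces linear inequalities between them to five cases. -/
lemma exists_scaledBound_window {n K : ℕ} (hK : K ≤ n) :
    ∃ r < 5, (r + K) % 5 = n % 5 ∧ ∃ x, 0 < x ∧ scaledBound n = x * scaledBound (r + K) ∧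
      ∀ k ≤ K, scaledBound (n - k) = x * scaledBound (r + K - k) := by
  have h := Nat.mod_add_div (n - K) 5
  refine ⟨(n - K) % 5, Nat.mod_lt _ (by norm_num), by omega, 10 ^ ((n - K) / 5), by positivity,
    ?_, fun k hk => ?_⟩
  · rw [← scaledBound_add_five_mul]
    congr 1
    omega
  · rw [← scaledBound_add_five_mul]
    congr 1
    omega

lemma scaledBound_degree_five {n j : ℕ} (hn : 7 ≤ n) (hj : 1 ≤ j) (hj5 : j ≤ 5) :
    scaledBound (n - 1) + ((5 - j) * scaledBound (n - 6) + j * scaledBound (n - 7)) <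
      scaledBound n := by
  obtain ⟨r, hr, -, x, hx, h0, h⟩ := exists_scaledBound_window hn
  rw [h0, h 1 (by norm_num), h 6 (by norm_num), h 7 (by norm_num)]
  interval_cases r <;> interval_cases j <;> simp [scaledBound] <;> omega

lemma scaledBound_degree_four {n j : ℕ} (hn : 6 ≤ n) (hj : 3 ≤ j) (hj4 : j ≤ 4) :
    scaledBound (n - 1) + ((4 - j) * scaledBound (n - 5) + j * scaledBound (n - 6)) <
      scaledBound n := by
  obtain ⟨r, hr, -, x, hx, h0, h⟩ := exists_scaledBound_window hn
  rw [h0, h 1 (by norm_num), h 5 (by norm_num), h 6 (by norm_num)]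
  interval_cases r <;> interval_cases j <;> simp [scaledBound] <;> omega

lemma scaledBound_degree_four_two {n : ℕ} (hn : 6 ≤ n) :
    scaledBound (n - 1) + (2 * scaledBound (n - 5) + 2 * scaledBound (n - 6)) ≤ scaledBound n ∧
      (scaledBound (n - 1) + (2 * scaledBound (n - 5) + 2 * scaledBound (n - 6)) =
        scaledBound n → n % 5 = 1 ∨ n % 5 = 2) := by
  obtain ⟨r, hr, hm, x, hx, h0, h⟩ := exists_scaledBound_window hn
  rw [h0, h 1 (by norm_num), h 5 (by norm_num), h 6 (by norm_num), ← hm]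
  interval_cases r <;> simp [scaledBound] <;> omega

lemma scaledBound_degree_three {n : ℕ} (hn : 5 ≤ n) :
    scaledBound (n - 1) + 3 * scaledBound (n - 5) < scaledBound n := by
  obtain ⟨r, hr, -, x, hx, h0, h⟩ := exists_scaledBound_window hn
  rw [h0, h 1 (by norm_num), h 5 (by norm_num)]
  interval_cases r <;> simp [scaledBound] <;> omega

lemma scaledBound_degree_three_two_step {n : ℕ} (hn : 5 ≤ n) :
    scaledBound (n - 3) + 3 * scaledBound (n - 4) + 2 * scaledBound (n - 5) < scaledBound n := by
  obtain ⟨r, hr, -, x, hx, h0, h⟩ := exists_scaledBound_window hn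
  rw [h0, h 3 (by norm_num), h 4 (by norm_num), h 5 (by norm_num)]
  interval_cases r <;> simp [scaledBound] <;> omega

lemma scaledBound_leaf {n : ℕ} (hn : 4 ≤ n) :
    scaledBound (n - 2) + 3 * scaledBound (n - 4) < scaledBound n := by
  obtain ⟨r, hr, -, x, hx, h0, h⟩ := exists_scaledBound_window hn
  rw [h0, h 2 (by norm_num), h 4 (by norm_num)]
  interval_cases r <;> simp [scaledBound] <;> omega

lemma scaledBound_degree_two {n : ℕ} (hn : 4 ≤ n) :
    scaledBound (n - 1) + 2 * scaledBound (n - 4) < scaledBound n := by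
  obtain ⟨r, hr, -, x, hx, h0, h⟩ := exists_scaledBound_window hn
  rw [h0, h 1 (by norm_num), h 4 (by norm_num)]
  interval_cases r <;> simp [scaledBound] <;> omega

lemma scaledBound_cut_vertex {n d e : ℕ} (hd : 2 ≤ d) (hd4 : d ≤ 4) (he : 2 ≤ e) (hed : e ≤ d)
    (hn : d + 2 ≤ n) :
    max 1 (d.choose 2) * scaledBound (n - (d + 1)) +
      (scaledBound (n - (d + 2)) + (e - 1) * scaledBound (n - (e + 1))) < scaledBound n := by
  obtain ⟨r, hr, -, x, hx, h0, h⟩ := exists_scaledBound_window hn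
  rw [h0, h (d + 1) (by omega), h (d + 2) (by omega), h (e + 1) (by omega)]
  interval_cases r <;> interval_cases d <;> interval_cases e <;>
    simp [scaledBound, Nat.choose] <;> omega

/-- Branching at a vertex of degree at least six loses. -/
lemma scaledBound_degree_ge_six {n d : ℕ} (hd : 6 ≤ d) (hn : d + 1 ≤ n) :
    scaledBound (n - 1) + d * scaledBound (n - (d + 1)) < scaledBound n := by
  obtain ⟨m, rfl⟩ : ∃ m, n = m + (d + 1) := ⟨n - (d + 1), by omega⟩
  have key : 3 * (d * scaledBound m) < scaledBound (m + (d + 1)) := by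
    clear hn
    induction d, hd using Nat.le_induction with
    | base =>
      obtain ⟨r, hr, -, x, hx, h0, h⟩ := exists_scaledBound_window (Nat.le_add_left 7 m)
      have h7 := h 7 le_rfl
      simp only [Nat.add_sub_cancel] at h7
      rw [h0, h7]
      interval_cases r <;> simp [scaledBound] <;> omega
    | succ d hd ih =>
      have h1 := three_mul_scaledBound_le (m + (d + 1))
      have h2 : 2 * scaledBound m ≤ d * scaledBound m := Nat.mul_le_mul_right _ (by omega)
      rw [show m + (d + 1 + 1) = m + (d + 1) + 1 by omega, add_mul]
      omega
  have h1 := three_mul_scaledBound_le (m + d)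
  rw [show m + (d + 1) - 1 = m + d by omega, Nat.add_sub_cancel,
    show m + (d + 1) = m + d + 1 by omega] at *
  omega

/-- Splitting off a clique component on `k` vertices never gains, and loses unless it leads from
an extremal graph to an extremal graph. -/
lemma scaledBound_clique {n k : ℕ} (hk : 3 ≤ k) (hk6 : k ≤ 6) (hn : k ≤ n) :
    k.choose 2 * scaledBound (n - k) ≤ scaledBound n ∧
      (k.choose 2 * scaledBound (n - k) = scaledBound n →
        k = 4 ∧ (n % 5 = 3 ∨ n % 5 = 4) ∨ k = 5 ∨ k = 6 ∧ (n % 5 = 1 ∨ n % 5 = 2)) := by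
  obtain ⟨r, hr, hm, x, hx, h0, h⟩ := exists_scaledBound_window hn
  rw [h0, h k le_rfl, ← hm]
  interval_cases k <;> interval_cases r <;> simp [scaledBound, Nat.choose] <;> omega

/-! ### Branching at a vertex -/

/-- All edges of `G` lie inside the vertex set `S`. -/
def SupportedOn (G : SimpleGraph V) (S : Finset V) : Prop := ∀ a b, G.Adj a b → a ∈ S

lemma SupportedOn.isolate [DecidableEq V] {G : SimpleGraph V} {S : Finset V}
    (h : G.SupportedOn S) (X : Finset V) : (G.isolate X).SupportedOn (S \ X) :=
  fun a b hab => Finset.mem_sdiff.2 ⟨h a b hab.1, by simpa using hab.2.1⟩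

lemma SupportedOn.mono {G : SimpleGraph V} {S T : Finset V} (h : G.SupportedOn S)
    (hST : S ⊆ T) : G.SupportedOn T :=
  fun a b hab => hST (h a b hab)

lemma SupportedOn.mimCount_eq_one {G : SimpleGraph V} {S : Finset V} (h : G.SupportedOn S)
    (hS : S.card ≤ 2) : G.mimCount = 1 := by
  classical
  have key : ∀ e ∈ G.edgeSet, e.toFinset = S := by
    intro e
    induction e with
    | h x y =>
      intro hxy
      have hxy : G.Adj x y := hxy
      refine Finset.eq_of_subset_of_card_le ?_ ?_
      · intro a ha
        rw [Sym2.mem_toFinset, Sym2.mem_iff] at ha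
        rcases ha with rfl | rfl
        exacts [h _ _ hxy, h _ _ hxy.symm]
      · rwa [Sym2.card_toFinset_of_not_isDiag _ (by simpa using hxy.ne)]
  refine SimpleGraph.mimCount_eq_one fun e he f hf _ => Sym2.ext fun a => ?_
  rw [← Sym2.mem_toFinset, ← Sym2.mem_toFinset, key e he, key f hf]

variable [Fintype V]

open Classical in
/-- The neighbours of `v` as a finite set. -/
noncomputable def nbrs (G : SimpleGraph V) (v : V) : Finset V := {w | G.Adj v w}

open Classical in
/-- The closed neighbourhood of `v` as a finite set. -/
noncomputable def closedNbrs (G : SimpleGraph V) (v : V) : Finset V := insert v (G.nbrs v)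

open Classical in
/-- The union of the closed neighbourhoods of `v` and `w`; once the edge `vw` is chosen, the other
edges of an induced matching avoid it. -/
noncomputable def edgeNbhd (G : SimpleGraph V) (v w : V) : Finset V :=
  G.closedNbrs v ∪ G.closedNbrs w

@[simp] lemma mem_nbrs {G : SimpleGraph V} {v w : V} : w ∈ G.nbrs v ↔ G.Adj v w := by
  simp [nbrs]

@[simp] lemma mem_closedNbrs {G : SimpleGraph V} {v w : V} :
    w ∈ G.closedNbrs v ↔ w = v ∨ G.Adj v w := by
  simp [closedNbrs]

@[simp] lemma mem_edgeNbhd {G : SimpleGraph V} {v w x : V} :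
    x ∈ G.edgeNbhd v w ↔ (x = v ∨ G.Adj v x) ∨ (x = w ∨ G.Adj w x) := by
  simp [edgeNbhd]

lemma card_closedNbrs (G : SimpleGraph V) (v : V) :
    (G.closedNbrs v).card = (G.nbrs v).card + 1 := by
  classical
  rw [closedNbrs, Finset.card_insert_of_notMem (by simp)]

lemma closedNbrs_subset_edgeNbhd (G : SimpleGraph V) (v w : V) :
    G.closedNbrs v ⊆ G.edgeNbhd v w := by
  classical
  exact Finset.subset_union_left

lemma edgeNbhd_comm (G : SimpleGraph V) (v w : V) : G.edgeNbhd v w = G.edgeNbhd w v := by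
  classical
  exact Finset.union_comm _ _

lemma succ_card_nbrs_le_card_edgeNbhd (G : SimpleGraph V) (v w : V) :
    (G.nbrs v).card + 1 ≤ (G.edgeNbhd v w).card := by
  rw [← card_closedNbrs]
  exact Finset.card_le_card (closedNbrs_subset_edgeNbhd G v w)

lemma card_nbrs_add_two_le_card_edgeNbhd {G : SimpleGraph V} {v w : V}
    (h : ¬ G.closedNbrs w ⊆ G.closedNbrs v) :
    (G.nbrs v).card + 2 ≤ (G.edgeNbhd v w).card := by
  classical
  have : G.closedNbrs v ⊂ G.edgeNbhd v w :=
    (closedNbrs_subset_edgeNbhd G v w).ssubset_of_ne fun h' =>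
      h (h' ▸ Finset.subset_union_right)
  have := Finset.card_lt_card this
  rw [card_closedNbrs] at this
  omega

/-- The branching inequality: a maximal induced matching either leaves `v` uncovered, and then is
maximal in `G - v`, or contains an edge `vw`, and then the rest of it is maximal in
`G - N[v] - N[w]`. -/
lemma mimCount_le_branch (G : SimpleGraph V) (v : V) :
    G.mimCount ≤ (G.isolate {v}).mimCount +
      ∑ w ∈ G.nbrs v, (G.isolate (G.edgeNbhd v w)).mimCount := by
  have hsub : G.maximalInducedMatchings ⊆ (G.isolate {v}).maximalInducedMatchings ∪
      ⋃ w ∈ G.nbrs v, insert s(v, w) '' (G.isolate (G.edgeNbhd v w)).maximalInducedMatchings := by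
    intro M hM
    obtain ⟨hE, hI, hdom⟩ := mem_maximalInducedMatchings_iff.1 hM
    by_cases hv : ∃ w, s(v, w) ∈ M
    · right
      obtain ⟨w, hw⟩ := hv
      have hvw : G.Adj v w := hE hw
      have havoid : ∀ e : Sym2 V,
          (∀ a ∈ e, a ∉ (G.edgeNbhd v w : Set V)) ↔ ¬ G.EdgeConflict s(v, w) e := by
        intro e
        simp only [EdgeConflict, Finset.mem_coe, mem_edgeNbhd, Sym2.mem_iff, exists_eq_or_imp,
          exists_eq_left, not_or, not_exists, not_and]
        constructor
        · rintro h
          exact ⟨fun a ha => ⟨fun h' => (h a ha).1.1 h'.symm, (h a ha).1.2⟩,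
            fun a ha => ⟨fun h' => (h a ha).2.1 h'.symm, (h a ha).2.2⟩⟩
        · rintro ⟨h1, h2⟩ a ha
          exact ⟨⟨fun h => (h1 a ha).1 h.symm, (h1 a ha).2⟩,
            fun h => (h2 a ha).1 h.symm, (h2 a ha).2⟩
      simp only [Set.mem_iUnion, mem_nbrs]
      refine ⟨w, hvw, M \ {s(v, w)}, ?_, by simp [Set.insert_eq_of_mem hw]⟩
      rw [mem_maximalInducedMatchings_isolate]
      refine ⟨fun e he => ⟨hE he.1, ?_⟩, fun e he f hf => hI e he.1 f hf.1, fun e he hX => ?_⟩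
      · exact (havoid e).2 fun hc => he.2 (hI _ hw e he.1 hc).symm
      · obtain ⟨f, hf, hc⟩ := hdom e he
        refine ⟨f, ⟨hf, ?_⟩, hc⟩
        rintro rfl
        exact (havoid e).1 hX hc.symm
    · left
      rw [mem_maximalInducedMatchings_isolate]
      refine ⟨fun e he => ⟨hE he, ?_⟩, hI, fun e he _ => hdom e he⟩
      rintro a ha rfl
      obtain ⟨w, rfl⟩ := ha
      exact hv ⟨w, he⟩
  calc G.mimCount ≤ _ := Set.ncard_le_ncard hsub (Set.toFinite _)
    _ ≤ _ := Set.ncard_union_le _ _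
    _ ≤ _ := Nat.add_le_add_left ((Finset.set_ncard_biUnion_le _ _).trans
      (Finset.sum_le_sum fun w _ => Set.ncard_image_le (Set.toFinite _))) _

lemma SupportedOn.closedNbrs_subset {G : SimpleGraph V} {S : Finset V} (h : G.SupportedOn S)
    {v : V} (hv : v ∈ S) : G.closedNbrs v ⊆ S := by
  intro w hw
  rcases mem_closedNbrs.1 hw with rfl | hw
  · exact hv
  · exact h w v hw.symm

lemma SupportedOn.edgeNbhd_subset {G : SimpleGraph V} {S : Finset V} (h : G.SupportedOn S)
    {v w : V} (hvw : G.Adj v w) : G.edgeNbhd v w ⊆ S := by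
  classical
  exact Finset.union_subset (h.closedNbrs_subset (h v w hvw)) (h.closedNbrs_subset (h w v hvw.symm))

/-- The upper bound, assumed for vertex sets with fewer than `n` elements. -/
def BoundBelow (V : Type*) [Fintype V] (n : ℕ) : Prop :=
  ∀ (G : SimpleGraph V) (S : Finset V), S.card < n → G.SupportedOn S →
    100 * G.mimCount ≤ scaledBound S.card

lemma BoundBelow.mono {m n : ℕ} (h : BoundBelow V n) (hmn : m ≤ n) : BoundBelow V m :=
  fun G S hS => h G S (hS.trans_le hmn)

lemma BoundBelow.le_of_sdiff [DecidableEq V] {S : Finset V} (ih : BoundBelow V S.card)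
    {H : SimpleGraph V} {X : Finset V} (hX : X ⊆ S) {k : ℕ} (hk : 1 ≤ k) (hkX : k ≤ X.card)
    (hH : H.SupportedOn (S \ X)) : 100 * H.mimCount ≤ scaledBound (S.card - k) := by
  have hc := Finset.card_sdiff_of_subset hX
  have hle := Finset.card_le_card hX
  exact (ih H (S \ X) (by omega) hH).trans (scaledBound_mono (by omega))

/-- On three, four or five vertices, rounding `scaledBound / 100` down gives the number of edges of
the complete graph; fewer vertices leave at most one edge. -/
lemma BoundBelow.le_choose {n : ℕ} (ih : BoundBelow V n) {H : SimpleGraph V} {S : Finset V}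
    (hS : S.card < n) (hS5 : S.card ≤ 5) (hH : H.SupportedOn S) :
    H.mimCount ≤ max 1 (S.card.choose 2) := by
  rcases le_or_gt S.card 2 with h2 | h2
  · rw [hH.mimCount_eq_one h2]
    exact le_max_left _ _
  · have := ih H S hS hH
    generalize S.card = m at *
    interval_cases m <;> simp [scaledBound, Nat.choose] at * <;> omega

/-- Branching at `v`: choosing an edge `vw` removes `N[v]`, and at least one more vertex if `N[w]`
is not contained in `N[v]`. -/
lemma BoundBelow.branch {G : SimpleGraph V} {S : Finset V} (ih : BoundBelow V S.card)
    (hG : G.SupportedOn S) {v : V} {j : ℕ}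
    [DecidablePred fun w => ¬ G.closedNbrs w ⊆ G.closedNbrs v]
    (hj : ((G.nbrs v).filter fun w => ¬ G.closedNbrs w ⊆ G.closedNbrs v).card = j) :
    100 * G.mimCount ≤ 100 * (G.isolate {v}).mimCount +
      (((G.nbrs v).card - j) * scaledBound (S.card - ((G.nbrs v).card + 1)) +
        j * scaledBound (S.card - ((G.nbrs v).card + 2))) := by
  classical
  have h := mimCount_le_branch G v
  have hsplit := Finset.card_filter_add_card_filter_not (s := G.nbrs v)
    (fun w => ¬ G.closedNbrs w ⊆ G.closedNbrs v)
  have hsum : 100 * ∑ w ∈ G.nbrs v, (G.isolate (G.edgeNbhd v w)).mimCount ≤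
      ((G.nbrs v).card - j) * scaledBound (S.card - ((G.nbrs v).card + 1)) +
        j * scaledBound (S.card - ((G.nbrs v).card + 2)) := by
    rw [Finset.mul_sum, ← Finset.sum_filter_not_add_sum_filter (G.nbrs v)
      (fun w => ¬ G.closedNbrs w ⊆ G.closedNbrs v)]
    refine Nat.add_le_add ?_ ?_
    · rw [show (G.nbrs v).card - j = ((G.nbrs v).filter
        fun w => ¬ ¬ G.closedNbrs w ⊆ G.closedNbrs v).card by omega, ← smul_eq_mul]
      refine Finset.sum_le_card_nsmul _ _ _ fun w hw => ?_
      have hvw := mem_nbrs.1 (Finset.mem_filter.1 hw).1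
      exact ih.le_of_sdiff (hG.edgeNbhd_subset hvw) (by omega)
        (succ_card_nbrs_le_card_edgeNbhd G v w) (hG.isolate _)
    · rw [← hj, ← smul_eq_mul]
      refine Finset.sum_le_card_nsmul _ _ _ fun w hw => ?_
      have hvw := mem_nbrs.1 (Finset.mem_filter.1 hw).1
      exact ih.le_of_sdiff (hG.edgeNbhd_subset hvw) (by omega)
        (card_nbrs_add_two_le_card_edgeNbhd (Finset.mem_filter.1 hw).2) (hG.isolate _)
  omega

/-! ### Vertices of degree at most four -/

lemma exists_adj_outside {G : SimpleGraph V} {v w : V} (hvw : G.Adj v w)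
    (h : ¬ G.closedNbrs w ⊆ G.closedNbrs v) : ∃ x, G.Adj w x ∧ x ≠ v ∧ ¬ G.Adj v x := by
  obtain ⟨x, hx, hxv⟩ := Finset.not_subset.1 h
  rw [mem_closedNbrs, not_or] at hxv
  rcases mem_closedNbrs.1 hx with rfl | hx
  · exact absurd hvw hxv.2
  · exact ⟨x, hx, hxv⟩

/-- Branching at a vertex `v` of degree three with a leaf `x` as a neighbour: deleting `v` isolates
`x`, so `G - v` may be bounded on two vertices fewer. -/
lemma BoundBelow.lt_of_leaf {G : SimpleGraph V} {S : Finset V} (ih : BoundBelow V S.card)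
    (hG : G.SupportedOn S) {v x : V} (hv : (G.nbrs v).card = 3) (hvx : G.Adj v x)
    (hx : ∀ y, G.Adj x y → y = v) : 100 * G.mimCount < scaledBound S.card := by
  classical
  have hvS := hG v x hvx
  have hxS := hG x v hvx.symm
  have hsub := hG.closedNbrs_subset hvS
  have hcard := Finset.card_le_card hsub
  rw [card_closedNbrs, hv] at hcard
  have hdel : 100 * (G.isolate {v}).mimCount ≤ scaledBound (S.card - 2) := by
    refine ih.le_of_sdiff (X := {v, x}) (by simp [Finset.insert_subset_iff, hvS, hxS]) (by norm_num)
      (by rw [Finset.card_pair hvx.ne]) ?_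
    rintro a b ⟨hab, ha, hb⟩
    refine Finset.mem_sdiff.2 ⟨hG a b hab, ?_⟩
    simp only [Finset.mem_insert, Finset.mem_singleton, not_or]
    refine ⟨ha, ?_⟩
    rintro rfl
    exact hb (hx b hab)
  have hb := ih.branch hG (v := v) rfl
  simp only [hv, Nat.reduceAdd] at hb
  set j := ((G.nbrs v).filter fun w => ¬ G.closedNbrs w ⊆ G.closedNbrs v).card with hj
  have hj3 : j ≤ 3 := hv ▸ Finset.card_filter_le _ _
  have h1 : scaledBound (S.card - 5) ≤ scaledBound (S.card - 4) := scaledBound_mono (by omega)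
  have h2 := Nat.mul_le_mul_left j h1
  have h3 : (3 - j) * scaledBound (S.card - 4) + j * scaledBound (S.card - 4) =
      3 * scaledBound (S.card - 4) := by rw [← add_mul, Nat.sub_add_cancel hj3]
  have := scaledBound_leaf hcard
  omega

/-- If exactly one neighbour `w` of `v` has a neighbour outside `N[v]`, branch at `w`: in `G - w`
the set `N[v] \ {w}` is a union of components. -/
lemma BoundBelow.lt_of_cut_vertex {G : SimpleGraph V} {S : Finset V} (ih : BoundBelow V S.card)
    (hG : G.SupportedOn S) {v w : V} (hd : 2 ≤ (G.nbrs v).card) (hd4 : (G.nbrs v).card ≤ 4)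
    (hvw : G.Adj v w) (hw : ¬ G.closedNbrs w ⊆ G.closedNbrs v)
    (hle : (G.nbrs w).card ≤ (G.nbrs v).card)
    (hfull : ∀ u, G.Adj v u → u ≠ w → G.closedNbrs u ⊆ G.closedNbrs v) :
    100 * G.mimCount < scaledBound S.card := by
  classical
  have hvS := hG v w hvw
  have hwS := hG w v hvw.symm
  have hn : (G.nbrs v).card + 2 ≤ S.card := (card_nbrs_add_two_le_card_edgeNbhd hw).trans
    (Finset.card_le_card (hG.edgeNbhd_subset hvw))
  have he : 2 ≤ (G.nbrs w).card := by
    obtain ⟨x, hwx, hxv, -⟩ := exists_adj_outside hvw hw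
    rw [← Finset.card_pair hxv]
    exact Finset.card_le_card (by simp [Finset.insert_subset_iff, hwx, hvw.symm])
  have hwX : w ∈ G.closedNbrs v := mem_closedNbrs.2 (Or.inr hvw)
  have hXcard : ((G.closedNbrs v).erase w).card = (G.nbrs v).card := by
    rw [Finset.card_erase_of_mem hwX, card_closedNbrs, Nat.add_sub_cancel]
  have hdel : 100 * (G.isolate {w}).mimCount ≤
      max 1 ((G.nbrs v).card.choose 2) * scaledBound (S.card - ((G.nbrs v).card + 1)) := by
    rw [mimCount_eq_mul (X := ((G.closedNbrs v).erase w : Finset V))]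
    · rw [← mul_assoc, mul_comm]
      refine Nat.mul_le_mul ?_ ?_
      · rw [← hXcard]
        refine ih.le_choose (by omega) (by omega) ?_
        intro a b hab
        exact Finset.mem_coe.1 (not_not.1 hab.2.1)
      · refine ih.le_of_sdiff (hG.closedNbrs_subset hvS) (by omega) (card_closedNbrs G v).ge ?_
        rintro a b ⟨⟨hab, haw, -⟩, ha, -⟩
        refine Finset.mem_sdiff.2 ⟨hG a b hab, fun h => ha ?_⟩
        exact Finset.mem_coe.2 (Finset.mem_erase.2 ⟨haw, h⟩)
    · rintro a b ⟨hab, haw, hbw⟩ ha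
      have ha := (Finset.mem_erase.1 (Finset.mem_coe.1 ha)).2
      refine Finset.mem_coe.2 (Finset.mem_erase.2 ⟨hbw, ?_⟩)
      rcases mem_closedNbrs.1 ha with rfl | hva
      · exact mem_closedNbrs.2 (Or.inr hab)
      · exact hfull a hva haw (mem_closedNbrs.2 (Or.inr hab))
  have hbr := mimCount_le_branch G w
  have hvN : v ∈ G.nbrs w := mem_nbrs.2 hvw.symm
  rw [← Finset.add_sum_erase _ _ hvN] at hbr
  have h1 : 100 * (G.isolate (G.edgeNbhd w v)).mimCount ≤
      scaledBound (S.card - ((G.nbrs v).card + 2)) := by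
    rw [edgeNbhd_comm]
    exact ih.le_of_sdiff (hG.edgeNbhd_subset hvw) (by omega)
      (card_nbrs_add_two_le_card_edgeNbhd hw) (hG.isolate _)
  have h2 : 100 * ∑ u ∈ (G.nbrs w).erase v, (G.isolate (G.edgeNbhd w u)).mimCount ≤
      ((G.nbrs w).card - 1) * scaledBound (S.card - ((G.nbrs w).card + 1)) := by
    rw [Finset.mul_sum, ← Finset.card_erase_of_mem hvN, ← smul_eq_mul (Finset.card _)]
    refine Finset.sum_le_card_nsmul _ _ _ fun u hu => ?_
    have hwu := mem_nbrs.1 (Finset.mem_erase.1 hu).2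
    exact ih.le_of_sdiff (hG.edgeNbhd_subset hwu) (by omega)
      (succ_card_nbrs_le_card_edgeNbhd G w u) (hG.isolate _)
  have := scaledBound_cut_vertex hd hd4 he hle hn
  omega

lemma nbrs_eq_triple {G : SimpleGraph V} [DecidableEq V] {v a b c : V}
    (hv : (G.nbrs v).card ≤ 3) (ha : G.Adj v a) (hb : G.Adj v b) (hc : G.Adj v c)
    (hab : a ≠ b) (hac : a ≠ c) (hbc : b ≠ c) : G.nbrs v = {a, b, c} := by
  symm
  refine Finset.eq_of_subset_of_card_le (by simp [Finset.insert_subset_iff, ha, hb, hc]) ?_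
  rw [Finset.card_eq_three.2 ⟨a, b, c, hab, hac, hbc, rfl⟩]
  exact hv

/-- In a graph of maximum degree three, suppose that `v` has three neighbours `w₁`, `w₂`, `w₃`, of
which exactly `w₂` and `w₃` have neighbours outside `N[v]`, and that `w₁` is adjacent to `w₂`. The
degree bound then forces `N(w₂) = {v, w₁, x}` with `x` outside `N[v]`. -/
lemma BoundBelow.lt_of_degree_three_of_adj {G : SimpleGraph V} {S : Finset V}
    (ih : BoundBelow V S.card) (hG : G.SupportedOn S) (hΔ : ∀ u, (G.nbrs u).card ≤ 3)
    {v w₁ w₂ w₃ : V} (hv : ∀ u, G.Adj v u ↔ u = w₁ ∨ u = w₂ ∨ u = w₃)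
    (h12 : w₁ ≠ w₂) (h13 : w₁ ≠ w₃) (h23 : w₂ ≠ w₃)
    (hw₁ : G.closedNbrs w₁ ⊆ G.closedNbrs v) (hw₂ : ¬ G.closedNbrs w₂ ⊆ G.closedNbrs v)
    (hw₃ : ¬ G.closedNbrs w₃ ⊆ G.closedNbrs v) (hadj : G.Adj w₁ w₂) :
    100 * G.mimCount < scaledBound S.card := by
  classical
  have hv1 : G.Adj v w₁ := (hv w₁).2 (by simp)
  have hv2 : G.Adj v w₂ := (hv w₂).2 (by simp)
  have hv3 : G.Adj v w₃ := (hv w₃).2 (by simp)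
  have hNv : G.nbrs v = {w₁, w₂, w₃} := nbrs_eq_triple (hΔ v) hv1 hv2 hv3 h12 h13 h23
  have hdv : (G.nbrs v).card = 3 := by
    rw [hNv]
    exact Finset.card_eq_three.2 ⟨_, _, _, h12, h13, h23, rfl⟩
  obtain ⟨x, h2x, hxv, hvx⟩ := exists_adj_outside hv2 hw₂
  have hx : x ≠ w₁ ∧ x ≠ w₂ ∧ x ≠ w₃ := by
    rw [hv] at hvx
    tauto
  have hN2 : G.nbrs w₂ = {v, w₁, x} :=
    nbrs_eq_triple (hΔ w₂) hv2.symm hadj.symm h2x hv1.ne (Ne.symm hxv) (Ne.symm hx.1)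
  have hd2 : (G.nbrs w₂).card = 3 := by
    rw [hN2]
    exact Finset.card_eq_three.2 ⟨_, _, _, hv1.ne, Ne.symm hxv, Ne.symm hx.1, rfl⟩
  have h2 : ∀ u, G.Adj w₂ u ↔ u = v ∨ u = w₁ ∨ u = x := by
    intro u
    rw [← mem_nbrs, hN2]
    simp
  have h1 : ∀ u, G.Adj w₁ u → u = v ∨ u = w₂ ∨ u = w₃ := by
    intro u hu
    have := mem_closedNbrs.1 (hw₁ (mem_closedNbrs.2 (Or.inr hu)))
    rw [hv] at this
    have := hu.ne'
    tauto
  have h23' : ¬ G.Adj w₂ w₃ := by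
    rw [h2]
    rintro (h | h | h)
    exacts [hv3.ne h.symm, h13 h.symm, hx.2.2 h.symm]
  have hn : 5 ≤ S.card := by
    have := card_nbrs_add_two_le_card_edgeNbhd hw₂
    have := Finset.card_le_card (hG.edgeNbhd_subset hv2)
    omega
  have hvS := hG v w₁ hv1
  have hdel : ∀ y ∈ S, 100 * (G.isolate {y}).mimCount ≤ scaledBound (S.card - 1) := fun y hy => by
    have := ih.le_of_sdiff (H := G.isolate {y}) (X := {y}) (k := 1) (by simpa using hy) le_rfl
      (by simp) (by simpa using hG.isolate {y})
    exact this
  by_cases h13' : G.Adj w₁ w₃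
  · -- `v` and `w₁` are twins whose neighbour `w₃` is not adjacent to `w₂`: branch at `w₂`.
    by_cases hleaf : ∀ y, G.Adj x y → y = w₂
    · exact ih.lt_of_leaf hG hd2 h2x hleaf
    · push Not at hleaf
      obtain ⟨y, hxy, hy⟩ := hleaf
      have hout : ∀ u ∈ G.nbrs w₂, ¬ G.closedNbrs u ⊆ G.closedNbrs w₂ := by
        have hw3 : w₃ ∉ G.closedNbrs w₂ := by
          rw [mem_closedNbrs, not_or]
          exact ⟨h23.symm, h23'⟩
        intro u hu hsub
        rw [mem_nbrs, h2] at hu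
        rcases hu with rfl | rfl | rfl
        · exact hw3 (hsub (mem_closedNbrs.2 (Or.inr hv3)))
        · exact hw3 (hsub (mem_closedNbrs.2 (Or.inr h13')))
        · have := mem_closedNbrs.1 (hsub (mem_closedNbrs.2 (Or.inr hxy)))
          rw [h2] at this
          rcases this with h | h | h | h
          · exact hy h
          · subst h; exact hvx hxy.symm
          · subst h
            rcases h1 u hxy.symm with h | h | h
            exacts [hxv h, hx.2.1 h, hx.2.2 h]
          · exact hxy.ne' h
      have hb := ih.branch hG (v := w₂) (j := 3)
        (by rw [Finset.filter_true_of_mem hout, hd2])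
      simp only [hd2, Nat.reduceAdd, Nat.sub_self, Nat.zero_mul, Nat.zero_add] at hb
      have := hdel w₂ (hG _ _ h2x)
      have := scaledBound_degree_three hn
      omega
  · -- Here `w₁` has no neighbours besides `v` and `w₂`: branch at `v`, and then at `w₂` in `G - v`.
    have hfilter : (G.nbrs v).filter (fun w => ¬ G.closedNbrs w ⊆ G.closedNbrs v) = {w₂, w₃} := by
      rw [hNv]
      ext u
      simp only [Finset.mem_filter, Finset.mem_insert, Finset.mem_singleton]
      constructor
      · rintro ⟨rfl | h, hu⟩
        · exact absurd hw₁ hu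
        · exact h
      · rintro (rfl | rfl)
        · exact ⟨by simp, hw₂⟩
        · exact ⟨by simp, hw₃⟩
    have hb := ih.branch hG (v := v) (j := 2) (by rw [hfilter, Finset.card_pair h23])
    simp only [hdv, Nat.reduceAdd, Nat.reduceSub, Nat.one_mul] at hb
    have hbr := mimCount_le_branch (G.isolate {v}) w₂
    have hNH : (G.isolate {v}).nbrs w₂ = {w₁, x} := by
      ext u
      simp only [mem_nbrs, isolate_adj, h2, Set.mem_singleton_iff, Finset.mem_insert,
        Finset.mem_singleton]
      constructor
      · rintro ⟨h | h, -, hu⟩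
        · exact absurd h hu
        · exact h
      · rintro (rfl | rfl)
        · exact ⟨by simp, hv2.ne', hv1.ne'⟩
        · exact ⟨by simp, hv2.ne', hxv⟩
    rw [hNH, Finset.sum_pair (Ne.symm hx.1)] at hbr
    have hw₁S := hG _ _ hadj
    have hw₂S := hG _ _ hadj.symm
    have hxS := hG _ _ h2x.symm
    have hcard3 : ({v, w₁, w₂} : Finset V).card = 3 :=
      Finset.card_eq_three.2 ⟨_, _, _, hv1.ne, hv2.ne, h12, rfl⟩
    have hcard4 : ({x, v, w₁, w₂} : Finset V).card = 4 := by
      rw [Finset.card_insert_of_notMem, hcard3]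
      simp only [Finset.mem_insert, Finset.mem_singleton, not_or]
      exact ⟨hxv, hx.1, hx.2.1⟩
    have hc : ∀ u, (G.isolate {v}).Adj w₂ u →
        100 * ((G.isolate {v}).isolate ((G.isolate {v}).edgeNbhd w₂ u)).mimCount ≤
          scaledBound (S.card - 4) := by
      intro u hu
      refine ih.le_of_sdiff (X := {x, v, w₁, w₂})
        (by simp [Finset.insert_subset_iff, hvS, hw₁S, hw₂S, hxS]) (by norm_num) hcard4.ge ?_
      rintro a b ⟨⟨hab, hav, -⟩, ha, -⟩
      refine Finset.mem_sdiff.2 ⟨hG a b hab, fun h => ?_⟩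
      rw [Finset.mem_coe, mem_edgeNbhd, ← mem_nbrs, hNH] at ha
      simp only [Finset.mem_insert, Finset.mem_singleton] at h ha
      have hav : a ≠ v := hav
      tauto
    have hcw := hc w₁ (by rw [← mem_nbrs, hNH]; simp)
    have hcx := hc x (by rw [← mem_nbrs, hNH]; simp)
    have hc0 : 100 * ((G.isolate {v}).isolate {w₂}).mimCount ≤ scaledBound (S.card - 3) := by
      refine ih.le_of_sdiff (X := {v, w₁, w₂})
        (by simp [Finset.insert_subset_iff, hvS, hw₁S, hw₂S]) (by norm_num) hcard3.ge ?_
      rintro a b ⟨⟨hab, hav, hbv⟩, ha, hb⟩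
      refine Finset.mem_sdiff.2 ⟨hG a b hab, fun h => ?_⟩
      simp only [Finset.mem_insert, Finset.mem_singleton] at h
      rcases h with h | rfl | h
      · exact hav h
      · rcases h1 b hab with h | h | rfl
        · exact hbv h
        · exact hb h
        · exact h13' hab
      · exact ha h
    have := scaledBound_degree_three_two_step hn
    omega

/-- If `w₁` is adjacent to neither `w₂` nor `w₃`, it is a leaf at `v`. -/
lemma BoundBelow.lt_of_degree_three {G : SimpleGraph V} {S : Finset V}
    (ih : BoundBelow V S.card) (hG : G.SupportedOn S) (hΔ : ∀ u, (G.nbrs u).card ≤ 3)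
    {v w₁ w₂ w₃ : V} (hv : ∀ u, G.Adj v u ↔ u = w₁ ∨ u = w₂ ∨ u = w₃)
    (h12 : w₁ ≠ w₂) (h13 : w₁ ≠ w₃) (h23 : w₂ ≠ w₃)
    (hw₁ : G.closedNbrs w₁ ⊆ G.closedNbrs v) (hw₂ : ¬ G.closedNbrs w₂ ⊆ G.closedNbrs v)
    (hw₃ : ¬ G.closedNbrs w₃ ⊆ G.closedNbrs v) :
    100 * G.mimCount < scaledBound S.card := by
  classical
  by_cases h2 : G.Adj w₁ w₂
  · exact ih.lt_of_degree_three_of_adj hG hΔ hv h12 h13 h23 hw₁ hw₂ hw₃ h2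
  by_cases h3 : G.Adj w₁ w₃
  · exact ih.lt_of_degree_three_of_adj hG hΔ (fun u => by rw [hv]; tauto) h13 h12 h23.symm
      hw₁ hw₃ hw₂ h3
  have hv1 : G.Adj v w₁ := (hv w₁).2 (by simp)
  refine ih.lt_of_leaf hG (v := v) (x := w₁) ?_ hv1 ?_
  · rw [nbrs_eq_triple (hΔ v) hv1 ((hv w₂).2 (by simp)) ((hv w₃).2 (by simp)) h12 h13 h23]
    exact Finset.card_eq_three.2 ⟨_, _, _, h12, h13, h23, rfl⟩
  · intro y hy
    have := mem_closedNbrs.1 (hw₁ (mem_closedNbrs.2 (Or.inr hy)))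
    rw [hv] at this
    rcases this with h | rfl | rfl | rfl
    · exact h
    · exact absurd hy (G.loopless.irrefl _)
    · exact absurd hy h2
    · exact absurd hy h3

/-! ### Clique components and the induction -/

/-- A component on three to six vertices with a dominating vertex has at most as many maximal
induced matchings as the complete graph, and fewer if it is not complete. -/
lemma BoundBelow.component {H : SimpleGraph V} {X : Finset V} (ih : BoundBelow V X.card)
    (hH : H.SupportedOn X) (h3 : 3 ≤ X.card) (h6 : X.card ≤ 6) {v : V} (hvX : v ∈ X)
    (hv : ∀ u ∈ X, u ≠ v → H.Adj v u) :
    H.mimCount ≤ X.card.choose 2 ∧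
      ∀ a ∈ X, ∀ b ∈ X, a ≠ b → ¬ H.Adj a b → H.mimCount < X.card.choose 2 := by
  classical
  have hdel : ∀ w ∈ X, (H.isolate {w}).mimCount ≤ max 1 ((X.card - 1).choose 2) := by
    intro w hw
    have hc := Finset.card_erase_of_mem hw
    rw [← hc]
    refine ih.le_choose (by omega) (by omega) ?_
    rintro a b ⟨hab, ha, -⟩
    exact Finset.mem_erase.2 ⟨ha, hH a b hab⟩
  have hone : ∀ u, (H.isolate (H.edgeNbhd v u)).mimCount = 1 := by
    intro u
    refine SupportedOn.mimCount_eq_one (S := ∅) ?_ (by simp)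
    rintro a b ⟨hab, ha, -⟩
    rw [Finset.mem_coe, mem_edgeNbhd] at ha
    by_cases hav : a = v
    · exact absurd (Or.inl (Or.inl hav)) ha
    · exact absurd (Or.inl (Or.inr (hv a (hH a b hab) hav))) ha
  constructor
  -- An edge at the dominating vertex is by itself maximal, and `H - v` is bounded by hypothesis.
  · have hb := mimCount_le_branch H v
    have hd := hdel v hvX
    have hcard : (H.nbrs v).card = X.card - 1 := by
      rw [← Finset.card_erase_of_mem hvX]
      congr 1
      ext u
      rw [mem_nbrs, Finset.mem_erase]
      exact ⟨fun h => ⟨h.ne', hH u v h.symm⟩, fun h => hv u h.2 h.1⟩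
    simp only [hone, Finset.sum_const, hcard, smul_eq_mul, mul_one] at hb
    generalize X.card = k at *
    interval_cases k <;> simp [Nat.choose] at * <;> omega
  -- Branching at an endpoint `a` of a missing edge: `av` is by itself maximal, and any other edge
  -- at `a` leaves only vertices outside `N[a]`.
  · intro a ha b hb hab hnab
    have hav : a ≠ v := by
      rintro rfl
      exact hnab (hv b hb hab.symm)
    have hva := hv a ha hav
    have hvN : v ∈ H.nbrs a := mem_nbrs.2 hva.symm
    have hbr := mimCount_le_branch H a
    have hd := hdel a ha
    rw [← Finset.add_sum_erase _ _ hvN, edgeNbhd_comm, hone] at hbr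
    have he1 : 1 ≤ (H.nbrs a).card := Finset.card_pos.2 ⟨v, hvN⟩
    have hsub : H.closedNbrs a ⊆ X := hH.closedNbrs_subset ha
    have he2 : (H.nbrs a).card + 2 ≤ X.card := by
      have : H.closedNbrs a ⊆ X.erase b := Finset.subset_erase.2
        ⟨hsub, by rw [mem_closedNbrs, not_or]; exact ⟨hab.symm, hnab⟩⟩
      have := Finset.card_le_card this
      rw [card_closedNbrs, Finset.card_erase_of_mem hb] at this
      omega
    have hsum : ∑ u ∈ (H.nbrs a).erase v, (H.isolate (H.edgeNbhd a u)).mimCount ≤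
        ((H.nbrs a).card - 1) * max 1 ((X.card - ((H.nbrs a).card + 1)).choose 2) := by
      rw [← Finset.card_erase_of_mem hvN, ← smul_eq_mul (Finset.card _)]
      refine Finset.sum_le_card_nsmul _ _ _ fun u _ => ?_
      have hc := Finset.card_sdiff_of_subset hsub
      rw [card_closedNbrs] at hc
      rw [← hc]
      exact ih.le_choose (by omega) (by omega) ((hH.isolate _).mono
        (Finset.sdiff_subset_sdiff subset_rfl (closedNbrs_subset_edgeNbhd H a u)))
    generalize X.card = k at *
    generalize ∑ u ∈ (H.nbrs a).erase v, (H.isolate (H.edgeNbhd a u)).mimCount = s at *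
    generalize (H.nbrs a).card = e at *
    have he4 : e ≤ 4 := by omega
    clear hone hdel ih
    interval_cases k <;> interval_cases e <;> simp [Nat.choose] at * <;> omega

omit [Fintype V] in
/-- Splitting off a component `X` that is a clique. -/
lemma nonempty_iso_of_clique [DecidableEq V] {G : SimpleGraph V} {S X : Finset V} {k : ℕ}
    (hXS : X ⊆ S) (hk : X.card = k) (hcl : ∀ a ∈ X, ∀ b ∈ X, a ≠ b → G.Adj a b)
    (hX : ∀ a b, G.Adj a b → a ∈ X → b ∈ X) {H : SimpleGraph W}
    (h : Nonempty ((G.isolate X).induce ((S \ X : Finset V) : Set V) ≃g H)) :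
    Nonempty (G.induce (S : Set V) ≃g ((⊤ : SimpleGraph (Fin k)) ⊕g H)) := by
  obtain ⟨e⟩ := h
  let g := (Finset.equivFinOfCardEq hk).symm
  have hY : ∀ y, (e.symm y : V) ∈ S ∧ (e.symm y : V) ∉ X := fun y =>
    Finset.mem_sdiff.1 (e.symm y).2
  let f : Fin k ⊕ W → (S : Set V) :=
    Sum.elim (fun i => ⟨g i, hXS (g i).2⟩) (fun y => ⟨e.symm y, (hY y).1⟩)
  have hf : Function.Bijective f := by
    constructor
    · rintro (i | y) (j | z) hij
      · exact congrArg Sum.inl (g.injective (Subtype.ext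
          (congrArg (fun z : (S : Set V) => (z : V)) hij)))
      · exact absurd ((congrArg Subtype.val hij : (g i : V) = e.symm z) ▸ (g i).2) (hY z).2
      · exact absurd ((congrArg Subtype.val hij : (e.symm y : V) = g j).symm ▸ (g j).2) (hY y).2
      · exact congrArg Sum.inr (e.symm.injective (Subtype.ext
          (congrArg (fun z : (S : Set V) => (z : V)) hij)))
    · rintro ⟨x, hx⟩
      by_cases hxX : x ∈ X
      · exact ⟨Sum.inl (g.symm ⟨x, hxX⟩), Subtype.ext (by simp [f])⟩
      · exact ⟨Sum.inr (e ⟨x, Finset.mem_sdiff.2 ⟨hx, hxX⟩⟩), Subtype.ext (by simp [f])⟩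
  refine ⟨RelIso.symm ⟨Equiv.ofBijective f hf, ?_⟩⟩
  rintro (i | y) (j | z)
  · change G.Adj (g i) (g j) ↔ i ≠ j
    constructor
    · rintro h rfl
      exact h.ne rfl
    · exact fun h => hcl _ (g i).2 _ (g j).2 fun h' => h (g.injective (Subtype.ext h'))
  · exact iff_of_false (fun h : G.Adj (g i) (e.symm z) => (hY z).2 (hX _ _ h (g i).2)) (by simp)
  · exact iff_of_false (fun h : G.Adj (e.symm y) (g j) => (hY y).2 (hX _ _ h.symm (g j).2))
      (by simp)
  · change G.Adj (e.symm y) (e.symm z) ↔ H.Adj y z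
    rw [← e.symm.map_adj_iff]
    exact ⟨fun h => ⟨h, (hY y).2, (hY z).2⟩, fun h => h.1⟩

/-- `G` restricted to `S` is an extremal graph. The redundant degree condition is what the
induction uses about extremal graphs. -/
def IsExtremalOn (G : SimpleGraph V) (S : Finset V) : Prop :=
  (S.card % 5 < 3 → ∀ v ∈ S, 4 ≤ (G.nbrs v).card) ∧
    ∃ a b c, IsExtremalShape S.card a b c ∧ Nonempty (G.induce (S : Set V) ≃g cliqueUnion a b c)

/-- The upper bound for `G` on the vertex set `S`, with the case of equality. -/
def BoundedOn (G : SimpleGraph V) (S : Finset V) : Prop :=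
  100 * G.mimCount ≤ scaledBound S.card ∧
    (100 * G.mimCount = scaledBound S.card → G.IsExtremalOn S)

lemma BoundedOn.of_lt {G : SimpleGraph V} {S : Finset V}
    (h : 100 * G.mimCount < scaledBound S.card) : G.BoundedOn S :=
  ⟨h.le, fun h' => absurd h' h.ne⟩

/-- The case of a vertex `v` such that `N[v]` is a component. -/
lemma boundedOn_of_component {G : SimpleGraph V} {S : Finset V}
    (ih : ∀ (H : SimpleGraph V) (T : Finset V), T.card < S.card → H.SupportedOn T → H.BoundedOn T)
    (hG : G.SupportedOn S) {v : V} (hv : v ∈ S) (hd : 2 ≤ (G.nbrs v).card)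
    (hd5 : (G.nbrs v).card ≤ 5)
    (hfull : ∀ u, G.Adj v u → G.closedNbrs u ⊆ G.closedNbrs v) : G.BoundedOn S := by
  classical
  have hB : BoundBelow V S.card := fun H T hT hH => (ih H T hT hH).1
  obtain ⟨X, hXdef⟩ : ∃ X, X = G.closedNbrs v := ⟨_, rfl⟩
  have hXS : X ⊆ S := hXdef ▸ hG.closedNbrs_subset hv
  have hXcard : X.card = (G.nbrs v).card + 1 := by rw [hXdef, card_closedNbrs]
  have hvX : v ∈ X := by simp [hXdef]
  have hle := Finset.card_le_card hXS
  have hclosed : ∀ a b, G.Adj a b → a ∈ X → b ∈ X := by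
    intro a b hab ha
    subst hXdef
    rcases mem_closedNbrs.1 ha with rfl | ha
    · exact mem_closedNbrs.2 (Or.inr hab)
    · exact hfull a ha (mem_closedNbrs.2 (Or.inr hab))
  have hmul : G.mimCount = _ := mimCount_eq_mul (X := (X : Set V)) (by simpa using hclosed)
  have hsuppX : (G.isolate (X : Set V)ᶜ).SupportedOn X := fun a b hab => by simpa using hab.2.1
  obtain ⟨hK, hK'⟩ := (hB.mono hle).component hsuppX (by omega) (by omega) hvX (by
    intro u hu huv
    have : G.Adj v u := (mem_closedNbrs.1 (hXdef ▸ hu)).resolve_left huv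
    simp [this, hvX, hu])
  have hsuppR := hG.isolate X
  have hRcard := Finset.card_sdiff_of_subset hXS
  obtain ⟨hR, hR'⟩ := ih _ (S \ X) (by omega) hsuppR
  obtain ⟨hnum, hnum'⟩ := scaledBound_clique (n := S.card) (k := X.card) (by omega) (by omega) hle
  rw [hRcard] at hR hR'
  have hprod : 100 * G.mimCount =
      (G.isolate (X : Set V)ᶜ).mimCount * (100 * (G.isolate (X : Set V)).mimCount) := by
    rw [hmul]
    ring
  have hpos := scaledBound_pos (S.card - X.card)
  have hchain : (G.isolate (X : Set V)ᶜ).mimCount * (100 * (G.isolate (X : Set V)).mimCount) ≤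
      X.card.choose 2 * scaledBound (S.card - X.card) := Nat.mul_le_mul hK hR
  refine ⟨by omega, fun heq => ?_⟩
  have hchoose : 0 < X.card.choose 2 := Nat.choose_pos (by omega)
  have hKeq : (G.isolate (X : Set V)ᶜ).mimCount = X.card.choose 2 := by
    refine hK.antisymm (not_lt.1 fun hlt => ?_)
    have h1 := Nat.mul_le_mul hlt.le hR
    have h2 : (G.isolate (X : Set V)ᶜ).mimCount * scaledBound (S.card - X.card) <
      X.card.choose 2 * scaledBound (S.card - X.card) := Nat.mul_lt_mul_of_pos_right hlt hpos
    have h3 := Nat.mul_le_mul_left (G.isolate (X : Set V)ᶜ).mimCount hR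
    omega
  have hReq : 100 * (G.isolate (X : Set V)).mimCount = scaledBound (S.card - X.card) := by
    refine hR.antisymm (not_lt.1 fun hlt => ?_)
    have h2 := Nat.mul_lt_mul_of_pos_left hlt hchoose
    rw [hprod, hKeq] at heq
    omega
  have hcl : ∀ a ∈ X, ∀ b ∈ X, a ≠ b → G.Adj a b := by
    intro a ha b hb hab
    by_contra hnab
    exact (hK' a ha b hb hab fun h => hnab h.1).ne hKeq
  have hcase := hnum' (by omega)
  obtain ⟨hdeg, a, b, c, hs, hiso⟩ := hR' hReq
  have hiso' := nonempty_iso_of_clique hXS rfl hcl hclosed hiso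
  rw [IsExtremalShape, hRcard] at hs
  refine ⟨fun hmod u hu => ?_, ?_⟩
  · by_cases huX : u ∈ X
    · have : X ⊆ G.closedNbrs u := by
        intro y hy
        by_cases hyu : y = u
        · exact mem_closedNbrs.2 (Or.inl hyu)
        · exact mem_closedNbrs.2 (Or.inr (hcl u huX y hy (Ne.symm hyu)))
      have := Finset.card_le_card this
      rw [card_closedNbrs] at this
      omega
    · have hmod' : (S \ X).card % 5 < 3 := by
        clear hs hprod hchain heq hR hR' hdeg hiso hiso' hKeq hReq
        omega
      refine (hdeg hmod' u (Finset.mem_sdiff.2 ⟨hu, huX⟩)).trans (Finset.card_le_card ?_)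
      intro y hy
      exact mem_nbrs.2 (mem_nbrs.1 hy).1
  · rcases hcase with ⟨hk, hmod⟩ | hk | ⟨hk, hmod⟩
    · rw [hk] at hiso'
      exact ⟨a + 1, b, c, by unfold IsExtremalShape; omega,
        nonempty_iso_cliqueUnion_succ_left hiso'⟩
    · rw [hk] at hiso'
      exact ⟨a, b + 1, c, by unfold IsExtremalShape; omega,
        nonempty_iso_cliqueUnion_succ_middle hiso'⟩
    · rw [hk] at hiso'
      exact ⟨a, b, c + 1, by unfold IsExtremalShape; omega,
        nonempty_iso_cliqueUnion_succ_right hiso'⟩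

/-- A graph of maximum degree at most one is itself an induced matching. -/
lemma boundedOn_of_degree_le_one {G : SimpleGraph V} {S : Finset V}
    (hΔ : ∀ v, (G.nbrs v).card ≤ 1) : G.BoundedOn S := by
  have huniq : ∀ {a b c}, G.Adj a b → G.Adj a c → b = c := fun {a b c} hb hc =>
    Finset.card_le_one.1 (hΔ a) b (mem_nbrs.2 hb) c (mem_nbrs.2 hc)
  have h1 : G.mimCount = 1 := by
    refine mimCount_eq_one ?_
    rintro e he f hf ⟨a, ⟨a', rfl⟩, b, ⟨b', rfl⟩, rfl | hab⟩
    · rw [huniq (show G.Adj a a' from he) (show G.Adj a b' from hf)]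
    · rw [huniq (show G.Adj a a' from he) hab, huniq (show G.Adj b b' from hf) hab.symm,
        Sym2.eq_swap]
  rcases Nat.eq_zero_or_pos S.card with h0 | hpos
  · have hS := Finset.card_eq_zero.1 h0
    subst hS
    refine ⟨by simp [h1, scaledBound], fun _ => ⟨by simp, 0, 0, 0, by simp [IsExtremalShape], ?_⟩⟩
    refine ⟨⟨@Equiv.equivOfIsEmpty _ _ (by simp) (by infer_instance), ?_⟩⟩
    rintro ⟨a, ha⟩
    simp at ha
  · have := scaledBound_strictMono hpos
    refine BoundedOn.of_lt ?_
    rw [h1]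
    exact this

/-- The bound with its equality case for all graphs, by induction on the number of vertices. -/
theorem boundedOn (n : ℕ) (G : SimpleGraph V) (S : Finset V) (hS : S.card = n)
    (hG : G.SupportedOn S) : G.BoundedOn S := by
  classical
  induction n using Nat.strong_induction_on generalizing G S with
  | _ n ihn =>
  subst hS
  have ih : ∀ (H : SimpleGraph V) (T : Finset V), T.card < S.card → H.SupportedOn T →
      H.BoundedOn T := fun H T hT hH => ihn _ hT H T rfl hH
  clear ihn
  have hB : BoundBelow V S.card := fun H T hT hH => (ih H T hT hH).1
  by_cases hΔ : ∀ v, (G.nbrs v).card ≤ 1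
  · exact boundedOn_of_degree_le_one hΔ
  push Not at hΔ
  obtain ⟨u₀, hu₀⟩ := hΔ
  obtain ⟨v, -, hmax⟩ := Finset.exists_max_image Finset.univ (fun v => (G.nbrs v).card)
    ⟨u₀, Finset.mem_univ _⟩
  have hmax : ∀ u, (G.nbrs u).card ≤ (G.nbrs v).card := fun u => hmax u (Finset.mem_univ _)
  have hd := hu₀.trans_le (hmax u₀)
  clear hu₀ u₀
  obtain ⟨w₀, hw₀⟩ := Finset.card_pos.1 (show 0 < (G.nbrs v).card by omega)
  have hvS := hG v w₀ (mem_nbrs.1 hw₀)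
  clear hw₀ w₀
  obtain ⟨J, hJ⟩ : ∃ J, J = (G.nbrs v).filter fun w => ¬ G.closedNbrs w ⊆ G.closedNbrs v :=
    ⟨_, rfl⟩
  have hmemJ : ∀ w, w ∈ J ↔ G.Adj v w ∧ ¬ G.closedNbrs w ⊆ G.closedNbrs v := by
    intro w
    rw [hJ, Finset.mem_filter, mem_nbrs]
  have hJle : J.card ≤ (G.nbrs v).card := hJ ▸ Finset.card_filter_le _ _
  have hb := hB.branch hG (v := v) (j := J.card) (by rw [hJ])
  have hdel : 100 * (G.isolate {v}).mimCount ≤ scaledBound (S.card - 1) := by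
    have := hB.le_of_sdiff (H := G.isolate {v}) (X := {v}) (k := 1) (by simpa using hvS) le_rfl
      (by simp) (by simpa using hG.isolate {v})
    exact this
  have hcard : (G.nbrs v).card + 1 ≤ S.card := by
    rw [← card_closedNbrs]
    exact Finset.card_le_card (hG.closedNbrs_subset hvS)
  have hcardJ : 1 ≤ J.card → (G.nbrs v).card + 2 ≤ S.card := by
    intro h
    obtain ⟨w, hw⟩ := Finset.card_pos.1 h
    rw [hmemJ] at hw
    exact (card_nbrs_add_two_le_card_edgeNbhd hw.2).trans
      (Finset.card_le_card (hG.edgeNbhd_subset hw.1))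
  rcases le_or_gt 6 (G.nbrs v).card with h6 | h6
  · refine BoundedOn.of_lt ?_
    have h1 := scaledBound_degree_ge_six h6 hcard
    have h2 : J.card * scaledBound (S.card - ((G.nbrs v).card + 2)) ≤
        J.card * scaledBound (S.card - ((G.nbrs v).card + 1)) :=
      Nat.mul_le_mul_left _ (scaledBound_mono (by omega))
    have h3 := add_mul ((G.nbrs v).card - J.card) J.card
      (scaledBound (S.card - ((G.nbrs v).card + 1)))
    rw [Nat.sub_add_cancel hJle] at h3
    omega
  rcases Nat.eq_zero_or_pos J.card with hJ0 | hJpos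
  · refine boundedOn_of_component ih hG hvS hd (by omega) fun u hu => ?_
    by_contra hcon
    have : u ∈ J := (hmemJ u).2 ⟨hu, hcon⟩
    rw [Finset.card_eq_zero.1 hJ0] at this
    simp at this
  have hn := hcardJ hJpos
  by_cases hJ1 : J.card = 1 ∧ (G.nbrs v).card ≤ 4
  · obtain ⟨w, hw⟩ := Finset.card_eq_one.1 hJ1.1
    have hwJ := (hmemJ w).1 (by simp [hw])
    refine BoundedOn.of_lt (hB.lt_of_cut_vertex hG hd hJ1.2 hwJ.1 hwJ.2 (hmax w) fun u hu huw => ?_)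
    by_contra hcon
    have : u ∈ J := (hmemJ u).2 ⟨hu, hcon⟩
    rw [hw, Finset.mem_singleton] at this
    exact huw this
  obtain hd' | hd' | hd' | hd' : (G.nbrs v).card = 2 ∨ (G.nbrs v).card = 3 ∨
      (G.nbrs v).card = 4 ∨ (G.nbrs v).card = 5 := by omega
  · have hJ2 : J.card = 2 := by omega
    simp only [hd', hJ2, Nat.reduceAdd, Nat.sub_self, Nat.zero_mul, Nat.zero_add] at hb
    have := scaledBound_degree_two (n := S.card) (by omega)
    exact BoundedOn.of_lt (by omega)
  · obtain hJ2 | hJ3 : J.card = 2 ∨ J.card = 3 := by omega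
    · obtain ⟨w₂, w₃, h23, hJeq⟩ := Finset.card_eq_two.1 hJ2
      obtain ⟨w₁, hw₁⟩ : (G.nbrs v \ J).Nonempty := by
        rw [← Finset.card_pos, Finset.card_sdiff_of_subset (hJ ▸ Finset.filter_subset _ _)]
        omega
      rw [Finset.mem_sdiff, mem_nbrs, hmemJ, not_and_not_right] at hw₁
      have h2 := (hmemJ w₂).1 (by simp [hJeq])
      have h3 := (hmemJ w₃).1 (by simp [hJeq])
      have hf1 := hw₁.2 hw₁.1
      have h12 : w₁ ≠ w₂ := fun h => h2.2 (h ▸ hf1)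
      have h13 : w₁ ≠ w₃ := fun h => h3.2 (h ▸ hf1)
      refine BoundedOn.of_lt (hB.lt_of_degree_three hG (fun u => hd' ▸ hmax u) (fun u => ?_)
        h12 h13 h23 hf1 h2.2 h3.2)
      rw [← mem_nbrs, nbrs_eq_triple hd'.le hw₁.1 h2.1 h3.1 h12 h13 h23]
      simp
    · simp only [hd', hJ3, Nat.reduceAdd, Nat.sub_self, Nat.zero_mul, Nat.zero_add] at hb
      have := scaledBound_degree_three (n := S.card) (by omega)
      exact BoundedOn.of_lt (by omega)
  · obtain hJ2 | hJ3 : J.card = 2 ∨ 3 ≤ J.card := by omega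
    · simp only [hd', hJ2, Nat.reduceAdd, Nat.reduceSub] at hb
      obtain ⟨hle, heq⟩ := scaledBound_degree_four_two (n := S.card) (by omega)
      refine BoundedOn.of_lt (lt_of_le_of_ne (by omega) fun hcon => ?_)
      -- Equality would make `G - v` extremal with minimum degree at least four.
      have hmod := heq (by omega)
      have hcS : (S \ {v}).card = S.card - 1 := by
        rw [Finset.card_sdiff_of_subset (by simpa using hvS), Finset.card_singleton]
      have hext := (ih (G.isolate {v}) (S \ {v}) (by omega) (by simpa using hG.isolate {v})).2
        (by rw [hcS]; omega)
      obtain ⟨w, hw⟩ := Finset.card_pos.1 (show 0 < (G.nbrs v).card by omega)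
      rw [mem_nbrs] at hw
      have h4 := hext.1 (by omega) w
        (Finset.mem_sdiff.2 ⟨hG w v hw.symm, by simpa using hw.ne'⟩)
      have hlt : ((G.isolate {v}).nbrs w).card < (G.nbrs w).card := by
        refine Finset.card_lt_card (Finset.ssubset_iff_subset_ne.2 ⟨fun y hy => ?_, fun h => ?_⟩)
        · exact mem_nbrs.2 (mem_nbrs.1 hy).1
        · have := mem_nbrs.1 (h ▸ mem_nbrs.2 hw.symm : v ∈ (G.isolate {v}).nbrs w)
          exact this.2.2 rfl
      have := hmax w
      omega
    · simp only [hd', Nat.reduceAdd] at hb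
      have := scaledBound_degree_four (n := S.card) (by omega) hJ3 (by omega)
      exact BoundedOn.of_lt (by omega)
  · simp only [hd', Nat.reduceAdd] at hb
    have := scaledBound_degree_five (n := S.card) (by omega) hJpos (by omega)
    exact BoundedOn.of_lt (by omega)

end SimpleGraph

theorem mainTheorem3 {V : Type*} [Fintype V] (n : ℕ) (hn : 8 ≤ n)
    (hV : Fintype.card V = n) (G : SimpleGraph V) :
    G.maximalInducedMatchings.ncard ≤ SimpleGraph.qBound n ∧
      (G.maximalInducedMatchings.ncard = SimpleGraph.qBound n ↔ SimpleGraph.IsQGraph n G) := by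
  obtain ⟨hle, heq⟩ := SimpleGraph.boundedOn n G Finset.univ hV fun a _ _ => Finset.mem_univ a
  rw [Finset.card_univ, hV, ← SimpleGraph.hundred_mul_qBound hn] at hle heq
  change G.mimCount ≤ _ ∧ (G.mimCount = _ ↔ _)
  refine ⟨by omega, fun h => ?_, fun h => ?_⟩
  · obtain ⟨-, a, b, c, hs, ⟨e⟩⟩ := heq (by omega)
    rw [Finset.card_univ, hV] at hs
    rw [Finset.coe_univ] at e
    exact (SimpleGraph.isQGraph_iff hn).2
      ⟨a, b, c, hs, ⟨(SimpleGraph.induceUnivIso G).symm.trans e⟩⟩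
  · obtain ⟨a, b, c, hs, ⟨e⟩⟩ := (SimpleGraph.isQGraph_iff hn).1 h
    have h1 := hs.scaledBound_eq
    have h2 := SimpleGraph.hundred_mul_qBound hn
    rw [SimpleGraph.mimCount_congr e, SimpleGraph.mimCount_cliqueUnion]
    omega
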